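/- Setting. Let $1\le d\le 3$, let $\mathcal O\subset\mathbb R^d$ be a bounded convex domain with polygonal boundary (the nonempty interior of the convex hull of finitely many points), $L^2=L^2(\mathcal O;\mathbb R)$, and let $\Lambda$ be the Laplacian on $\mathcal O$ with homogeneous Dirichlet boundary condition, with eigenpairs $-\Lambda e_i=\lambda_i e_i$, $0<\lambda_1\le\lambda_2\le\cdots$, where $\{e_i\}$ is an orthonormal basis of $L^2$. Put $\dot{\mathbb H}^1=\mathcal D((-\Lambda)^{1/2})$, $\|u\|_{\dot{\mathbb H}^1}=\|(-\Lambda)^{1/2}u\|_{L^2}$ and $\mathbb H^1=\dot{\mathbb H}^1\times L^2$. Let $\mathbf Q$ be a symmetric, positive definite operator of finite trace on $L^2$ with positive square root $\mathbf Q^{1/2}$; $\mathcal L_2(\mathbf Q^{1/2}(L^2),L^2)$ denotes the Hilbert–Schmidt operators, with norm $\|S\|_{\mathcal L_2}=\big(\sum_k\|S\mathbf Q^{1/2}e_k\|_{L^2}^2\big)^{1/2}$. Let $W(t)=\sum_k\beta_k(t)\,\mathbf Q^{1/2}e_k$, where the $\beta_k$ are independent real Brownian motions with respect to a filtration $(\mathcal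 F_t)_{t\ge0}$ on a probability space $(\Omega,\mathcal F,\mathbb P)$. For $u\in\dot{\mathbb H}^1$ write $\Theta u=(u,\partial_{x_1}u,\dots,\partial_{x_d}u)$. Assumptions. Let $k\ge1$ be an integer, $\widetilde F:\mathbb R\to\mathbb R$ differentiable, $f:\dot{\mathbb H}^1\to L^2$ with $f(u)=\widetilde F'(u)$, $F(u)=\int_{\mathcal O}\widetilde F(u(x))\,dx$ (the integral exists for all $u\in\dot{\mathbb H}^1$), and $g:\dot{\mathbb H}^1\times (L^2)^d\to\mathcal L_2(\mathbf Q^{1/2}(L^2),L^2)$. Suppose that there are polynomials $b_1,b_2,b_3$ of degrees at most $2k+1$, $2k$, $k$ and constants $c_2\ge 0$, $c_2',c_3,c_4,\delta_0,c>0$ such that for all $u,\widetilde u\in\dot{\mathbb H}^1$ $$\|f(u)\|_{L^2}\le b_1(\|u\|_{\dot{\mathbb H}^1}),\qquad \|f(u)-f(\widetilde u)\|_{L^2}\le b_2(\|u\|_{\dot{\mathbb H}^1},\|\widetilde u\|_{\dot{\mathbb H}^1})\|u-\widetilde u\|_{\dot{\mathbb H}^1},$$ $$\|g(\Theta u)\|_{\mathcal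 L_2}\le c_2\big(1+\|u\|_{L^{2k+2}}^{k+1}+\|u\|_{\dot{\mathbb H}^1}\big),\qquad \|g(\Theta u)\|_{\mathcal L_2}\le c_2'(1+\|u\|_{\dot{\mathbb H}^1}),$$ $$\|g(\Theta u)-g(\Theta\widetilde u)\|_{\mathcal L_2}\le b_3(\|u\|_{\dot{\mathbb H}^1},\|\widetilde u\|_{\dot{\mathbb H}^1})\|u-\widetilde u\|_{\dot{\mathbb H}^1},$$ $$F(u)+\delta_0\ge c_3\|u\|_{L^2}^2+c_4\|u\|_{L^{2k+2}}^{2k+2},\qquad F(u)+\delta_0\ge c .$$ Let $X_0=(u_0,v_0)$ be an $\mathcal F_0$-measurable $\mathbb H^1$-valued random variable with $\mathbb E\|X_0\|_{\mathbb H^1}^r<\infty$ for all $r\ge 0$ (for instance a deterministic element of $\mathbb H^1$). Schemes. For $T>0$, $N\in\mathbb N^+$ and $\tau$ with $N\tau=T$ put $t_n=n\tau$ and $\delta W_n=W(t_{n+1})-W(t_n)$, where $g(\Theta u_n)\delta W_n=\sum_k(\beta_k(t_{n+1})-\beta_k(t_n))\,g(\Theta u_n)\mathbf Q^{1/2}e_k$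 as a limit in probability in $L^2$. Let $\widehat u_n=u_n$ for all $n$, or $\widehat u_n=\frac{3u_n-u_{n-1}}2$ for all $n$ with $u_{-1}=u_0$. A numerical solution is a sequence of $\mathcal F_{t_n}$-measurable $(u_n,v_n,q_n)\in\dot{\mathbb H}^1\times L^2\times\mathbb R$, $0\le n\le N$, with $(u_0,v_0)=X_0$, $q_0=\sqrt{F(u_0)+\delta_0}$, such that almost surely, for $0\le n\le N-1$, $$q_{n+1}=q_n+\frac{\langle f(\widehat u_n),u_{n+1}-u_n\rangle_{L^2}}{2\sqrt{F(\widehat u_n)+\delta_0}}$$ together with either the midpoint SAV scheme (second equation in $\dot{\mathbb H}^{-1}$) $$u_{n+1}=u_n+\tfrac\tau2(v_n+v_{n+1})+\tfrac\tau2 g(\Theta u_n)\delta W_n,$$ $$v_{n+1}=v_n+\tfrac\tau2\Lambda(u_n+u_{n+1})-\tau\frac{f(\widehat u_n)}{\sqrt{F(\widehat u_n)+\delta_0}}\frac{q_n+q_{n+1}}2+g(\Theta u_n)\delta W_n,$$ or the exponential Euler SAV scheme $$X_{n+1}=E(\tau)X_n+A^{-1}(E(\tau)-I)\Big(0,-\frac{f(\widehat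 u_n)}{\sqrt{F(\widehat u_n)+\delta_0}}\frac{q_n+q_{n+1}}2\Big)^\top+E(\tau)(0,g(\Theta u_n)\delta W_n)^\top ,$$ where $X_n=(u_n,v_n)^\top$, $A(u,v)^\top=(v,\Lambda u)^\top$ and $$E(t)=\exp(tA)=\begin{bmatrix}\cos(t(-\Lambda)^{1/2})&(-\Lambda)^{-1/2}\sin(t(-\Lambda)^{1/2})\\-(-\Lambda)^{1/2}\sin(t(-\Lambda)^{1/2})&\cos(t(-\Lambda)^{1/2})\end{bmatrix}.$$ Claim. For every $p\ge1$ there is a constant $C>0$, depending only on $p$, $X_0$, $\mathbf Q$, $T$ and the data $\mathcal O,f,g,\delta_0$ of the problem (not on $N$, $\tau$, the filtration, the Brownian motions, the scheme or the choice of $\widehat u_n$), such that every numerical solution of either scheme satisfies $$\sup_{j\in\{0,1,\dots,N-1\}}\mathbb E\big[\|u_{j+1}-u_j\|_{L^2}^p\big]\le C\tau^p .$$ -/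

import Mathlib

open MeasureTheory ProbabilityTheory Filter Topology
open scoped NNReal ENNReal

namespace SAVWave

/-! ### The domain, weak derivatives and the Dirichlet Laplacian -/

/-- `ℝ^d` with its Euclidean norm. -/
abbrev Pt (d : ℕ) : Type := EuclideanSpace ℝ (Fin d)

/-- `L²(𝒪; ℝ)`. -/
abbrev L2 {d : ℕ} (O : Set (Pt d)) : Type := Lp ℝ 2 ((volume : Measure (Pt d)).restrict O)

/-- Bounded convex domain with polygonal boundary: the nonempty interior of the convex hull of
finitely many points. -/
def IsConvexPolygonalDomain {d : ℕ} (O : Set (Pt d)) : Prop :=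
  O.Nonempty ∧ ∃ s : Finset (Pt d), O = interior (convexHull ℝ (s : Set (Pt d)))

/-- `C_c^∞(𝒪)`. -/
structure IsTestFunction {d : ℕ} (O : Set (Pt d)) (φ : Pt d → ℝ) : Prop where
  smooth : ContDiff ℝ ((⊤ : ℕ∞) : WithTop ℕ∞) φ
  compact : HasCompactSupport φ
  support : tsupport φ ⊆ O

/-- The classical partial derivative `∂_{x_j} φ`. -/
noncomputable def partialDeriv {d : ℕ} (j : Fin d) (φ : Pt d → ℝ) (x : Pt d) : ℝ :=
  fderiv ℝ φ x (EuclideanSpace.single j 1)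

/-- `w ∈ L²(𝒪)` is the weak partial derivative `∂_{x_j} u` of `u ∈ L²(𝒪)`. -/
def IsWeakPartial {d : ℕ} (O : Set (Pt d)) (j : Fin d) (u w : L2 O) : Prop :=
  ∀ φ : Pt d → ℝ, IsTestFunction O φ →
    ∫ x in O, u x * partialDeriv j φ x = - ∫ x in O, w x * φ x

open Classical in
/-- The weak partial derivative in `L²(𝒪)` (it is unique when it exists; value `0` otherwise). -/
noncomputable def weakPartial {d : ℕ} (O : Set (Pt d)) (j : Fin d) (u : L2 O) : L2 O :=
  if h : ∃ w : L2 O, IsWeakPartial O j u w then h.choose else 0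

/-- `u ∈ H¹₀(𝒪)`: the closure of `C_c^∞(𝒪)` in `H¹(𝒪)`. -/
def MemH10 {d : ℕ} (O : Set (Pt d)) (u : L2 O) : Prop :=
  (∀ j, ∃ w : L2 O, IsWeakPartial O j u w) ∧
  ∃ φ : ℕ → Pt d → ℝ, (∀ n, IsTestFunction O (φ n)) ∧
    Tendsto (fun n => eLpNorm (fun x => u x - φ n x) 2 (volume.restrict O)) atTop (𝓝 0) ∧
    ∀ j, Tendsto (fun n => eLpNorm (fun x => weakPartial O j u x - partialDeriv j (φ n) x) 2
      (volume.restrict O)) atTop (𝓝 0)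

/-- `(lam i, e i)` are the eigenpairs of `-Λ`, the negative Laplacian with homogeneous Dirichlet
boundary condition: `0 < lam 0 ≤ lam 1 ≤ ⋯`, the `e i` form an orthonormal basis of `L²(𝒪)`, lie in
`H¹₀(𝒪)`, and solve `-Λ (e i) = lam i • e i` weakly. -/
structure IsDirichletEigenbasis {d : ℕ} (O : Set (Pt d)) (lam : ℕ → ℝ)
    (e : HilbertBasis ℕ ℝ (L2 O)) : Prop where
  pos : ∀ i, 0 < lam i
  mono : Monotone lam
  memH10 : ∀ i, MemH10 O (e i)
  eigen : ∀ i, ∀ φ : Pt d → ℝ, IsTestFunction O φ →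
    ∑ j, ∫ x in O, weakPartial O j (e i) x * partialDeriv j φ x
      = lam i * ∫ x in O, e i x * φ x

/-! ### Spectral calculus of the Dirichlet Laplacian -/

/-- The domain of the operator `∑ x_i e_i ↦ ∑ (m i) x_i e_i`. -/
def specDomain {H : Type*} [NormedAddCommGroup H] [InnerProductSpace ℝ H]
    (e : HilbertBasis ℕ ℝ H) (m : ℕ → ℝ) : Submodule ℝ H where
  carrier := {x | Memℓp (fun i => m i * e.repr x i) 2}
  zero_mem' := by
    have h : (fun i => m i * e.repr (0 : H) i) = 0 := by
      funext i; simp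
    rw [Set.mem_ofPred_eq, h]
    exact zero_memℓp
  add_mem' := by
    intro x y hx hy
    have h : (fun i => m i * e.repr (x + y) i)
        = (fun i => m i * e.repr x i) + (fun i => m i * e.repr y i) := by
      funext i; simp [mul_add]
    rw [Set.mem_ofPred_eq, h]
    exact Memℓp.add hx hy
  smul_mem' := by
    intro c x hx
    have h : (fun i => m i * e.repr (c • x) i) = c • (fun i => m i * e.repr x i) := by
      funext i; simp; ring
    rw [Set.mem_ofPred_eq, h]
    exact Memℓp.const_smul hx c

open Classical in
/-- The operator `∑ x_i e_i ↦ ∑ (m i) x_i e_i` on `specDomain e m` (value `0` off the domain). -/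
noncomputable def specOp {H : Type*} [NormedAddCommGroup H] [InnerProductSpace ℝ H]
    (e : HilbertBasis ℕ ℝ H) (m : ℕ → ℝ) (x : H) : H :=
  if h : Memℓp (fun i => m i * e.repr x i) 2 then
    e.repr.symm (⟨fun i => m i * e.repr x i, h⟩ : lp (fun _ : ℕ => ℝ) 2) else 0

/-- `Ḣ¹ = 𝒟((-Λ)^{1/2})`. -/
noncomputable abbrev HdotOne {H : Type*} [NormedAddCommGroup H] [InnerProductSpace ℝ H]
    (e : HilbertBasis ℕ ℝ H) (lam : ℕ → ℝ) : Submodule ℝ H :=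
  specDomain e (fun i => √(lam i))

/-- `‖u‖_{Ḣ¹} = ‖(-Λ)^{1/2} u‖_{L²}`. -/
noncomputable def hdotNorm {H : Type*} [NormedAddCommGroup H] [InnerProductSpace ℝ H]
    (e : HilbertBasis ℕ ℝ H) (lam : ℕ → ℝ) (u : HdotOne e lam) : ℝ :=
  ‖specOp e (fun i => √(lam i)) (u : H)‖

/-- The norm of `ℍ¹ = Ḣ¹ × L²`. -/
noncomputable def phaseNorm {H : Type*} [NormedAddCommGroup H] [InnerProductSpace ℝ H]
    (e : HilbertBasis ℕ ℝ H) (lam : ℕ → ℝ) (u : HdotOne e lam) (v : H) : ℝ :=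
  √(hdotNorm e lam u ^ 2 + ‖v‖ ^ 2)

/-- The wave group `E(t) = exp(tA)`, `A (u, v) = (v, Λ u)`, i.e.
`E(t)(u,v) = (𝒞(t) u + (-Λ)^{-1/2} 𝒮(t) v, -(-Λ)^{1/2} 𝒮(t) u + 𝒞(t) v)`; it is only applied to
`u ∈ Ḣ¹`, `v ∈ L²`. -/
noncomputable def waveGroup {H : Type*} [NormedAddCommGroup H] [InnerProductSpace ℝ H]
    (e : HilbertBasis ℕ ℝ H) (lam : ℕ → ℝ) (t : ℝ) (X : H × H) : H × H :=
  (specOp e (fun i => Real.cos (t * √(lam i))) X.1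
      + specOp e (fun i => (√(lam i))⁻¹ * Real.sin (t * √(lam i))) X.2,
    - specOp e (fun i => √(lam i) * Real.sin (t * √(lam i))) X.1
      + specOp e (fun i => Real.cos (t * √(lam i))) X.2)

/-- `A⁻¹ (a, b) = (Λ⁻¹ b, a)`. -/
noncomputable def waveInv {H : Type*} [NormedAddCommGroup H] [InnerProductSpace ℝ H]
    (e : HilbertBasis ℕ ℝ H) (lam : ℕ → ℝ) (X : H × H) : H × H :=
  (specOp e (fun i => - (lam i)⁻¹) X.2, X.1)

/-! ### The covariance operator and Hilbert–Schmidt operators on `𝐐^{1/2}(L²)` -/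

/-- `Q` is symmetric, positive definite and of finite trace, and `R` is its positive square root
`𝐐^{1/2}`. -/
structure IsCovarianceWithSqrt {H : Type*} [NormedAddCommGroup H] [InnerProductSpace ℝ H]
    (e : HilbertBasis ℕ ℝ H) (Q R : H →L[ℝ] H) : Prop where
  symm : ∀ x y, inner ℝ (Q x) y = inner ℝ x (Q y)
  posDef : ∀ x, x ≠ 0 → 0 < inner ℝ (Q x) x
  finiteTrace : Summable (fun k => inner ℝ (Q (e k)) (e k))
  sqrt_symm : ∀ x y, inner ℝ (R x) y = inner ℝ x (R y)
  sqrt_nonneg : ∀ x, 0 ≤ inner ℝ (R x) x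
  sqrt_sq : R.comp R = Q

/-- Linear maps on the space `𝐐^{1/2}(H)`, with values in `H`. -/
abbrev NoiseOp {H : Type*} [NormedAddCommGroup H] [InnerProductSpace ℝ H]
    (R : H →L[ℝ] H) : Type _ :=
  (LinearMap.range (R : H →ₗ[ℝ] H)) →ₗ[ℝ] H

/-- `S 𝐐^{1/2}` for a linear map `S` on `𝐐^{1/2}(H)`. -/
noncomputable def NoiseOp.compSqrt {H : Type*} [NormedAddCommGroup H] [InnerProductSpace ℝ H]
    {R : H →L[ℝ] H} (S : NoiseOp R) : H →ₗ[ℝ] H :=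
  S.comp (R : H →ₗ[ℝ] H).rangeRestrict

/-- `S ∈ 𝓛₂(𝐐^{1/2}(H), H)`. As `𝐐^{1/2}(H)` carries the norm that makes the injective map
`𝐐^{1/2}` an isometry from `H`, this says that `S 𝐐^{1/2}` is Hilbert–Schmidt on `H`. -/
def IsHilbertSchmidt {H : Type*} [NormedAddCommGroup H] [InnerProductSpace ℝ H]
    (e : HilbertBasis ℕ ℝ H) {R : H →L[ℝ] H} (S : NoiseOp R) : Prop :=
  Continuous S.compSqrt ∧ Summable (fun k => ‖S.compSqrt (e k)‖ ^ 2)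

/-- `‖S‖_{𝓛₂(𝐐^{1/2}(H), H)}`. -/
noncomputable def hsNorm {H : Type*} [NormedAddCommGroup H] [InnerProductSpace ℝ H]
    (e : HilbertBasis ℕ ℝ H) {R : H →L[ℝ] H} (S : NoiseOp R) : ℝ :=
  √(∑' k, ‖S.compSqrt (e k)‖ ^ 2)

/-! ### The coefficients -/

/-- `F(u) = ∫_𝒪 F̃(u(x)) dx`. -/
noncomputable def potential {d : ℕ} (O : Set (Pt d)) (Ft : ℝ → ℝ) (u : L2 O) : ℝ :=
  ∫ x in O, Ft (u x)

/-- `g(Θ u)`, where `Θ u = (u, ∂_{x_1} u, …, ∂_{x_d} u)`. -/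
noncomputable def gTheta {d : ℕ} {O : Set (Pt d)} {lam : ℕ → ℝ} {e : HilbertBasis ℕ ℝ (L2 O)}
    {R : L2 O →L[ℝ] L2 O} (g : HdotOne e lam → (Fin d → L2 O) → NoiseOp R) (u : HdotOne e lam) :
    NoiseOp R :=
  g u (fun j => weakPartial O j (u : L2 O))

/-- The superlinear assumption on the drift `f : Ḣ¹ → L²`, `f(u) = F̃'(u)`, and on the diffusion
coefficient `g : Ḣ¹ × (L²)^d → 𝓛₂(𝐐^{1/2}(L²), L²)`. -/
structure SuperlinearAssumption {d : ℕ} (O : Set (Pt d)) (lam : ℕ → ℝ)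
    (e : HilbertBasis ℕ ℝ (L2 O)) (R : L2 O →L[ℝ] L2 O) (k : ℕ) (delta0 : ℝ) (Ft : ℝ → ℝ)
    (f : HdotOne e lam → L2 O) (g : HdotOne e lam → (Fin d → L2 O) → NoiseOp R) : Prop where
  one_le_k : 1 ≤ k
  sqrtQ_hs : Summable (fun i => ‖R (e i)‖ ^ 2)
  f_growth : ∃ b₁ : Polynomial ℝ, b₁.natDegree ≤ 2 * k + 1 ∧
    ∀ u, ‖f u‖ ≤ b₁.eval (hdotNorm e lam u)
  f_lipschitz : ∃ b₂ : MvPolynomial (Fin 2) ℝ, b₂.totalDegree ≤ 2 * k ∧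
    ∀ u w, ‖f u - f w‖ ≤
      MvPolynomial.eval ![hdotNorm e lam u, hdotNorm e lam w] b₂ * hdotNorm e lam (u - w)
  g_hs : ∀ u (z : Fin d → L2 O), IsHilbertSchmidt e (g u z)
  g_growth : ∃ c₂ : ℝ, 0 ≤ c₂ ∧ ∀ u,
    ENNReal.ofReal (hsNorm e (gTheta g u)) ≤ ENNReal.ofReal c₂ *
      (1 + eLpNorm (u : L2 O) ((2 * k + 2 : ℕ) : ℝ≥0∞) (volume.restrict O) ^ (k + 1)
        + ENNReal.ofReal (hdotNorm e lam u))
  g_lipschitz : ∃ b₃ : MvPolynomial (Fin 2) ℝ, b₃.totalDegree ≤ k ∧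
    ∀ u w, hsNorm e (gTheta g u - gTheta g w) ≤
      MvPolynomial.eval ![hdotNorm e lam u, hdotNorm e lam w] b₃ * hdotNorm e lam (u - w)
  delta0_pos : 0 < delta0
  Ft_differentiable : Differentiable ℝ Ft
  f_eq : ∀ u, (f u : Pt d → ℝ) =ᵐ[volume.restrict O] fun x => deriv Ft ((u : L2 O) x)
  potential_integrable : ∀ u : HdotOne e lam,
    Integrable (fun x => Ft ((u : L2 O) x)) (volume.restrict O)
  coercive : ∃ c₃ c₄ : ℝ, 0 < c₃ ∧ 0 < c₄ ∧ ∀ u : HdotOne e lam,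
    ENNReal.ofReal (c₃ * ‖(u : L2 O)‖ ^ 2)
      + ENNReal.ofReal c₄ * ∫⁻ x in O, ‖(u : L2 O) x‖ₑ ^ (2 * k + 2)
      ≤ ENNReal.ofReal (potential O Ft u + delta0)

/-! ### The driving noise -/

/-- `β 0, β 1, …` are independent Brownian motions with respect to the filtration `ℱ`. The
`𝐐`-Wiener process is `W(t) = ∑ k, β k t • 𝐐^{1/2} e_k`. -/
structure IsBrownianSequence {Ω : Type*} {mΩ : MeasurableSpace Ω} (P : Measure Ω)
    (ℱ : Filtration ℝ≥0 mΩ) (β : ℕ → ℝ≥0 → Ω → ℝ) : Prop where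
  brownian : ∀ k, IsBrownianReal (β k) P
  indep : iIndepFun (fun k ω t => β k t ω) P
  adapted : ∀ k t, StronglyMeasurable[ℱ t] (β k t)
  indep_past : ∀ s t, s ≤ t →
    Indep (MeasurableSpace.comap (fun ω k => β k t ω - β k s ω) inferInstance) (ℱ s) P

/-- `G = S (W(t) - W(s))` for a random Hilbert–Schmidt operator `S`: the series
`∑ k, (β k t - β k s) • S 𝐐^{1/2} e_k` converges to `G` in probability. -/
def IsNoiseIncrement {Ω : Type*} {mΩ : MeasurableSpace Ω} (P : Measure Ω)
    {H : Type*} [NormedAddCommGroup H] [InnerProductSpace ℝ H]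
    (e : HilbertBasis ℕ ℝ H) {R : H →L[ℝ] H} (β : ℕ → ℝ≥0 → Ω → ℝ) (s t : ℝ≥0)
    (S : Ω → NoiseOp R) (G : Ω → H) : Prop :=
  TendstoInMeasure P
    (fun m ω => ∑ k ∈ Finset.range m, (β k t ω - β k s ω) • (S ω).compSqrt (e k)) atTop G

/-! ### The two SAV schemes -/

/-- The two choices of `û_n`. -/
inductive Extrapolation where
  | current
  | linear

/-- `û_n = u_n`, or `û_n = (3 u_n - u_{n-1}) / 2` with `u_{-1} = u_0` (for `n = 0`, truncated
subtraction gives `u (n - 1) = u 0`). -/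
noncomputable def Extrapolation.hat (x : Extrapolation) {V : Type*} [AddCommGroup V] [Module ℝ V]
    (u : ℕ → V) (n : ℕ) : V :=
  match x with
  | .current => u n
  | .linear => (1 / 2 : ℝ) • ((3 : ℝ) • u n - u (n - 1))

/-- `f(û) / √(F(û) + δ₀)`. -/
noncomputable def scaledDrift {d : ℕ} {O : Set (Pt d)} {lam : ℕ → ℝ}
    {e : HilbertBasis ℕ ℝ (L2 O)} (delta0 : ℝ) (Ft : ℝ → ℝ) (f : HdotOne e lam → L2 O)
    (w : HdotOne e lam) : L2 O :=
  (√(potential O Ft (w : L2 O) + delta0))⁻¹ • f w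

/-- What the two schemes share: processes `u_n ∈ Ḣ¹`, `v_n ∈ L²`, `q_n ∈ ℝ` for `n ≤ N` that are
adapted to `ℱ` at the times `t_n = n τ`, start at `(u_0, v_0, √(F(u_0) + δ₀))`, and satisfy
`q_{n+1} = q_n + ⟨f(û_n), u_{n+1} - u_n⟩ / (2 √(F(û_n) + δ₀))`. -/
structure IsSAVProcess {Ω : Type*} {mΩ : MeasurableSpace Ω} (P : Measure Ω)
    (ℱ : Filtration ℝ≥0 mΩ) {d : ℕ} {O : Set (Pt d)} {lam : ℕ → ℝ} {e : HilbertBasis ℕ ℝ (L2 O)}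
    (delta0 : ℝ) (Ft : ℝ → ℝ) (f : HdotOne e lam → L2 O) (u₀ : Ω → HdotOne e lam) (v₀ : Ω → L2 O)
    (x : Extrapolation) (N : ℕ) (τ : ℝ≥0)
    (u : ℕ → Ω → HdotOne e lam) (v : ℕ → Ω → L2 O) (q : ℕ → Ω → ℝ) : Prop where
  adapted_u : ∀ n ≤ N, StronglyMeasurable[ℱ (n * τ)] (fun ω => (u n ω : L2 O))
  adapted_v : ∀ n ≤ N, StronglyMeasurable[ℱ (n * τ)] (v n)
  adapted_q : ∀ n ≤ N, StronglyMeasurable[ℱ (n * τ)] (q n)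
  init_u : ∀ᵐ ω ∂P, u 0 ω = u₀ ω
  init_v : ∀ᵐ ω ∂P, v 0 ω = v₀ ω
  init_q : ∀ᵐ ω ∂P, q 0 ω = √(potential O Ft (u₀ ω : L2 O) + delta0)
  step_q : ∀ n < N, ∀ᵐ ω ∂P, q (n + 1) ω = q n ω +
    (1 / 2) * inner ℝ (scaledDrift delta0 Ft f (x.hat (fun m => u m ω) n))
      ((u (n + 1) ω : L2 O) - (u n ω : L2 O))

/-- Numerical solutions of the midpoint SAV scheme
`u_{n+1} = u_n + τ/2 (v_n + v_{n+1}) + τ/2 g(Θ u_n) δW_n`,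
`v_{n+1} = v_n + τ/2 Λ(u_n + u_{n+1}) - τ f(û_n)/√(F(û_n)+δ₀) (q_n + q_{n+1})/2 + g(Θ u_n) δW_n`.
As `Λ (u_n + u_{n+1})` is in general an element of `Ḣ⁻¹`, the second equation is stated in `Ḣ⁻¹`,
i.e. for the coefficients with respect to the eigenbasis. -/
def IsMidpointSAV {Ω : Type*} {mΩ : MeasurableSpace Ω} (P : Measure Ω)
    (ℱ : Filtration ℝ≥0 mΩ) (β : ℕ → ℝ≥0 → Ω → ℝ) {d : ℕ} {O : Set (Pt d)} {lam : ℕ → ℝ}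
    {e : HilbertBasis ℕ ℝ (L2 O)} {R : L2 O →L[ℝ] L2 O} (delta0 : ℝ) (Ft : ℝ → ℝ)
    (f : HdotOne e lam → L2 O) (g : HdotOne e lam → (Fin d → L2 O) → NoiseOp R)
    (u₀ : Ω → HdotOne e lam) (v₀ : Ω → L2 O) (x : Extrapolation) (N : ℕ) (τ : ℝ≥0)
    (u : ℕ → Ω → HdotOne e lam) (v : ℕ → Ω → L2 O) (q : ℕ → Ω → ℝ) : Prop :=
  IsSAVProcess P ℱ delta0 Ft f u₀ v₀ x N τ u v q ∧
  ∃ G : ℕ → Ω → L2 O, ∀ n < N,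
    IsNoiseIncrement P e β (n * τ) ((n + 1 : ℕ) * τ) (fun ω => gTheta g (u n ω)) (G n) ∧
    ∀ᵐ ω ∂P,
      (u (n + 1) ω : L2 O) = (u n ω : L2 O) + ((τ : ℝ) / 2) • (v n ω + v (n + 1) ω)
        + ((τ : ℝ) / 2) • G n ω ∧
      ∀ i, e.repr (v (n + 1) ω) i = e.repr (v n ω) i
        + (τ : ℝ) / 2 * (- lam i * e.repr ((u n ω : L2 O) + (u (n + 1) ω : L2 O)) i)
        - (τ : ℝ) * ((q n ω + q (n + 1) ω) / 2)
            * e.repr (scaledDrift delta0 Ft f (x.hat (fun m => u m ω) n)) i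
        + e.repr (G n ω) i

/-- Numerical solutions of the exponential Euler SAV scheme
`X_{n+1} = E(τ) X_n + A⁻¹ (E(τ) - I) (0, -f(û_n)/√(F(û_n)+δ₀) (q_n + q_{n+1})/2)
  + E(τ) (0, g(Θ u_n) δW_n)` with `X_n = (u_n, v_n)`. -/
def IsExponentialSAV {Ω : Type*} {mΩ : MeasurableSpace Ω} (P : Measure Ω)
    (ℱ : Filtration ℝ≥0 mΩ) (β : ℕ → ℝ≥0 → Ω → ℝ) {d : ℕ} {O : Set (Pt d)} {lam : ℕ → ℝ}
    {e : HilbertBasis ℕ ℝ (L2 O)} {R : L2 O →L[ℝ] L2 O} (delta0 : ℝ) (Ft : ℝ → ℝ)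
    (f : HdotOne e lam → L2 O) (g : HdotOne e lam → (Fin d → L2 O) → NoiseOp R)
    (u₀ : Ω → HdotOne e lam) (v₀ : Ω → L2 O) (x : Extrapolation) (N : ℕ) (τ : ℝ≥0)
    (u : ℕ → Ω → HdotOne e lam) (v : ℕ → Ω → L2 O) (q : ℕ → Ω → ℝ) : Prop :=
  IsSAVProcess P ℱ delta0 Ft f u₀ v₀ x N τ u v q ∧
  ∃ G : ℕ → Ω → L2 O, ∀ n < N,
    IsNoiseIncrement P e β (n * τ) ((n + 1 : ℕ) * τ) (fun ω => gTheta g (u n ω)) (G n) ∧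
    ∀ᵐ ω ∂P,
      let Y : L2 O × L2 O :=
        (0, - (((q n ω + q (n + 1) ω) / 2) •
          scaledDrift delta0 Ft f (x.hat (fun m => u m ω) n)))
      ((u (n + 1) ω : L2 O), v (n + 1) ω) =
        waveGroup e lam τ ((u n ω : L2 O), v n ω)
          + waveInv e lam (waveGroup e lam τ Y - Y)
          + waveGroup e lam τ (0, G n ω)

end SAVWave

namespace SAVWave

/-! ### Spectral calculus in coordinates -/

section Spectral

variable {H : Type*} [NormedAddCommGroup H] [InnerProductSpace ℝ H] {e : HilbertBasis ℕ ℝ H}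
  {lam : ℕ → ℝ}

/-! Both schemes have the same structure. One step first kicks the velocity, replacing `v` by `v +
G` with `G` the noise increment, and then runs a deterministic step which conserves the modified
energy `1 + ‖u‖²/2 + ‖v‖²/2 + q²` exactly (`‖u‖` taken in `Ḣ¹`). Indeed the drift does the work `-(q
+ q') / 2 * ⟪F, u' - u⟫`, where `F` is the scaled drift, and the auxiliary variable is updated so
that `⟪F, u' - u⟫ = 2 (q' - q)`; the work is therefore `q² - q'²`. Hence the energy changes only
through the kick, `W' = W + ⟪v, G⟫ + ‖G‖² / 2` (`savEnergy_step`, `scheme_step`).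

Given the past, `G` is a centred Gaussian sum. By the linear growth of `g` its squared
Hilbert–Schmidt norm is at most a constant times `W`. When `(W + ⟪v, G⟫ + ‖G‖² / 2) ^ m` is
expanded, the first-order inner product has mean zero and all that remains is at most a constant
times `τ W ^ m`. So each step multiplies the `m`-th moment by at most `1 + ρ τ`
(`lintegral_energy_pow_step_le`), and `N τ = T` bounds the product of these factors by `exp (ρ T)`
(`lintegral_savEnergy_pow_le`). The initial moments are finite because the potential grows
polynomially in the `Ḣ¹` norm (`potential_le`).

Finally `u' - u` is `τ` times quantities that the energies control. The noise enters it only through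
`τ ‖v + G‖`, and `‖v + G‖` is bounded by the energy after the step, so `G` needs no separate
estimate. This yields `‖u' - u‖ ≤ τ D Z ^ (2k+2)` pathwise, with `Z` a sum of three energies
(`exists_increment_bound`), and the energy moments finish the proof. -/

lemma memlp_two_iff {a : ℕ → ℝ} : Memℓp a 2 ↔ Summable fun i => a i ^ 2 := by
  rw [memℓp_gen_iff (by norm_num)]
  simp

lemma hasSum_repr_mul (x y : H) : HasSum (fun i => e.repr x i * e.repr y i) (inner ℝ x y) := by
  simpa [e.repr_apply_apply, real_inner_comm] using e.hasSum_inner_mul_inner x y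

lemma hasSum_repr_sq (x : H) : HasSum (fun i => e.repr x i ^ 2) (‖x‖ ^ 2) := by
  simpa [sq, real_inner_self_eq_norm_sq] using hasSum_repr_mul (e := e) x x

lemma repr_specOp {m : ℕ → ℝ} {x : H} (h : Memℓp (fun i => m i * e.repr x i) 2) (i : ℕ) :
    e.repr (specOp e m x) i = m i * e.repr x i := by
  rw [specOp, dif_pos h, LinearIsometryEquiv.apply_symm_apply]

lemma hasSum_specOp_sq {m : ℕ → ℝ} {x : H} (h : Memℓp (fun i => m i * e.repr x i) 2) :
    HasSum (fun i => (m i * e.repr x i) ^ 2) (‖specOp e m x‖ ^ 2) := by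
  simpa [repr_specOp h] using hasSum_repr_sq (e := e) (specOp e m x)

lemma memlp_mul_of_bound {m m' : ℕ → ℝ} {x : H} {C : ℝ} (hm : ∀ i, |m i| ≤ C * |m' i|)
    (h : Memℓp (fun i => m' i * e.repr x i) 2) : Memℓp (fun i => m i * e.repr x i) 2 := by
  rw [memlp_two_iff] at h ⊢
  refine Summable.of_nonneg_of_le (fun i => sq_nonneg _) (fun i => ?_) (h.mul_left (C ^ 2))
  rw [mul_pow, mul_pow, ← mul_assoc]
  refine mul_le_mul_of_nonneg_right ?_ (sq_nonneg _)
  rw [← sq_abs (m i), ← sq_abs (m' i), ← mul_pow]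
  exact pow_le_pow_left₀ (abs_nonneg _) (hm i) 2

lemma memlp_mul_of_bounded {m : ℕ → ℝ} {C : ℝ} (hm : ∀ i, |m i| ≤ C) (x : H) :
    Memℓp (fun i => m i * e.repr x i) 2 := by
  refine memlp_mul_of_bound (m' := fun _ => 1) (C := C) (by simpa using hm) ?_
  simpa using (hasSum_repr_sq (e := e) x).summable |> memlp_two_iff.2

lemma norm_le_of_coord {x z : H} {C : ℝ} (hC : 0 ≤ C)
    (h : ∀ i, |e.repr z i| ≤ C * |e.repr x i|) : ‖z‖ ≤ C * ‖x‖ := by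
  rw [← abs_of_nonneg (norm_nonneg z), ← abs_of_nonneg (mul_nonneg hC (norm_nonneg x)),
    ← sq_le_sq, mul_pow]
  refine hasSum_le (fun i => ?_) (hasSum_repr_sq (e := e) z)
    ((hasSum_repr_sq (e := e) x).mul_left (C ^ 2))
  rw [← sq_abs, ← sq_abs (e.repr x i), ← mul_pow]
  exact pow_le_pow_left₀ (abs_nonneg _) (h i) 2

lemma hasSum_hdotNorm_sq (hlam : ∀ i, 0 < lam i) (u : HdotOne e lam) :
    HasSum (fun i => lam i * e.repr (u : H) i ^ 2) (hdotNorm e lam u ^ 2) := by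
  have := hasSum_specOp_sq (e := e) (m := fun i => √(lam i)) (x := (u : H)) u.2
  simpa [mul_pow, Real.sq_sqrt (hlam _).le, hdotNorm] using this

lemma hdotNorm_nonneg (u : HdotOne e lam) : 0 ≤ hdotNorm e lam u := norm_nonneg _

/-- Poincaré's inequality: `lam 0` is the smallest eigenvalue. -/
lemma norm_le_hdotNorm (hlam : ∀ i, 0 < lam i) (hmono : Monotone lam) (u : HdotOne e lam) :
    ‖(u : H)‖ ≤ (√(lam 0))⁻¹ * hdotNorm e lam u := by
  refine norm_le_of_coord (e := e) (by positivity) fun i => ?_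
  rw [repr_specOp u.2, abs_mul, ← mul_assoc, abs_of_nonneg (Real.sqrt_nonneg _)]
  have h0 : 0 < √(lam 0) := Real.sqrt_pos.2 (hlam 0)
  have h1 : 1 ≤ (√(lam 0))⁻¹ * √(lam i) := by
    rw [inv_mul_eq_div, one_le_div h0]
    exact Real.sqrt_le_sqrt (hmono (Nat.zero_le i))
  exact le_mul_of_one_le_left (abs_nonneg _) h1

/-- The energy balance of one step of a scheme, from its coordinatewise form. -/
lemma energy_balance_of_coord (hlam : ∀ i, 0 < lam i) {u u' : HdotOne e lam} {w v' y : H}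
    (h : ∀ i, lam i * e.repr (u' : H) i ^ 2 + e.repr v' i ^ 2
        - 2 * (e.repr y i * e.repr (u' : H) i)
      = lam i * e.repr (u : H) i ^ 2 + e.repr w i ^ 2 - 2 * (e.repr y i * e.repr (u : H) i)) :
    hdotNorm e lam u' ^ 2 + ‖v'‖ ^ 2
      = hdotNorm e lam u ^ 2 + ‖w‖ ^ 2 + 2 * inner ℝ y ((u' : H) - u) := by
  have h1 := ((hasSum_hdotNorm_sq hlam u').add (hasSum_repr_sq (e := e) v')).sub
    ((hasSum_repr_mul (e := e) y (u' : H)).mul_left 2)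
  have h2 := ((hasSum_hdotNorm_sq hlam u).add (hasSum_repr_sq (e := e) w)).sub
    ((hasSum_repr_mul (e := e) y (u : H)).mul_left 2)
  simp only [h] at h1
  have := h1.unique h2
  rw [inner_sub_right]
  linarith

/-- In each coordinate, multiply the velocity equation by `w + v'` and the displacement equation by
`lam i` times the sum of the two displacements, less twice the force. The right-hand sides cancel.
Here `w` is the velocity after the noise kick. -/
lemma midpoint_energy_balance (hlam : ∀ i, 0 < lam i) {τ : ℝ} {u u' : HdotOne e lam} {w v' y : H}
    (hu : (u' : H) = u + (τ / 2) • (w + v'))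
    (hv : ∀ i, e.repr v' i = e.repr w i
      + τ / 2 * (- lam i * e.repr ((u : H) + u') i) + τ * e.repr y i) :
    hdotNorm e lam u' ^ 2 + ‖v'‖ ^ 2
      = hdotNorm e lam u ^ 2 + ‖w‖ ^ 2 + 2 * inner ℝ y ((u' : H) - u) := by
  refine energy_balance_of_coord hlam fun i => ?_
  have h1 : e.repr (u' : H) i = e.repr (u : H) i + τ / 2 * (e.repr w i + e.repr v' i) := by
    conv_lhs => rw [hu]
    simp only [map_add, map_smul, lp.coeFn_add, lp.coeFn_smul, Pi.add_apply, Pi.smul_apply,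
      smul_eq_mul]
  have h2 := hv i
  simp only [map_add, lp.coeFn_add, Pi.add_apply] at h2
  generalize e.repr (u : H) i = a at *
  generalize e.repr (u' : H) i = a' at *
  generalize e.repr w i = b at *
  generalize e.repr v' i = b' at *
  generalize e.repr y i = c at *
  linear_combination (b' + b) * h2 - (lam i * (a + a') - 2 * c) * (-h1)

lemma norm_midpoint_increment_le {τ : ℝ} (hτ : 0 ≤ τ) {u u' w v' : H}
    (hu : u' = u + (τ / 2) • (w + v')) : ‖u' - u‖ ≤ τ * (‖w‖ + ‖v'‖) := by
  rw [hu, add_sub_cancel_left, norm_smul, Real.norm_of_nonneg (by positivity)]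
  have := norm_add_le w v'
  nlinarith [norm_nonneg w, norm_nonneg v']

/-- The exponential Euler step in coordinates. -/
lemma exponential_step_coord (hlam : ∀ i, 0 < lam i) (hmono : Monotone lam) {τ : ℝ}
    {u u' : HdotOne e lam} {v G v' y : H}
    (h : ((u' : H), v') = waveGroup e lam τ ((u : H), v)
      + waveInv e lam (waveGroup e lam τ (0, y) - (0, y)) + waveGroup e lam τ (0, G)) (i : ℕ) :
    e.repr (u' : H) i = Real.cos (τ * √(lam i)) * e.repr (u : H) i
        + (√(lam i))⁻¹ * Real.sin (τ * √(lam i)) * e.repr (v + G) i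
        + (lam i)⁻¹ * (1 - Real.cos (τ * √(lam i))) * e.repr y i ∧
    e.repr v' i = - (√(lam i) * Real.sin (τ * √(lam i)) * e.repr (u : H) i)
        + Real.cos (τ * √(lam i)) * e.repr (v + G) i
        + (√(lam i))⁻¹ * Real.sin (τ * √(lam i)) * e.repr y i := by
  -- `specOp` is zero off its domain, so membership must be checked before coordinates can be read
  -- off. The multiplier in `hM` is unbounded, and there `u ∈ Ḣ¹` is needed.
  have hC : ∀ x : H, Memℓp (fun i => Real.cos (τ * √(lam i)) * e.repr x i) 2 :=
    memlp_mul_of_bounded (C := 1) fun i => Real.abs_cos_le_one _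
  have hS : ∀ x : H,
      Memℓp (fun i => (√(lam i))⁻¹ * Real.sin (τ * √(lam i)) * e.repr x i) 2 := by
    refine memlp_mul_of_bounded (C := (√(lam 0))⁻¹) fun i => ?_
    rw [abs_mul, abs_of_nonneg (by positivity)]
    refine (mul_le_of_le_one_right (by positivity) (Real.abs_sin_le_one _)).trans ?_
    exact inv_anti₀ (Real.sqrt_pos.2 (hlam 0)) (Real.sqrt_le_sqrt (hmono (Nat.zero_le i)))
  have hL : ∀ x : H, Memℓp (fun i => -(lam i)⁻¹ * e.repr x i) 2 := by
    refine memlp_mul_of_bounded (C := (lam 0)⁻¹) fun i => ?_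
    rw [abs_neg, abs_of_pos (inv_pos.2 (hlam i))]
    exact inv_anti₀ (hlam 0) (hmono (Nat.zero_le i))
  have hM : ∀ x : HdotOne e lam,
      Memℓp (fun i => √(lam i) * Real.sin (τ * √(lam i)) * e.repr (x : H) i) 2 := by
    intro x
    refine memlp_mul_of_bound (C := 1) (fun i => ?_) x.2
    rw [abs_mul, one_mul]
    exact mul_le_of_le_one_right (abs_nonneg _) (Real.abs_sin_le_one _)
  have hM0 := hM 0
  rw [Submodule.coe_zero] at hM0
  have h1 := congrArg (fun z : H × H => e.repr z.1 i) h
  have h2 := congrArg (fun z : H × H => e.repr z.2 i) h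
  simp only [waveGroup, waveInv, Prod.fst_add, Prod.snd_add, Prod.fst_sub, Prod.snd_sub, map_add,
    map_sub, map_neg, lp.coeFn_add, lp.coeFn_sub, lp.coeFn_neg, Pi.add_apply, Pi.sub_apply,
    Pi.neg_apply, repr_specOp (hC _), repr_specOp (hS _), repr_specOp (hL _), repr_specOp (hM _),
    repr_specOp hM0, map_zero, lp.coeFn_zero, Pi.zero_apply, mul_zero, neg_zero, zero_add,
    sub_zero] at h1 h2
  simp only [map_add, lp.coeFn_add, Pi.add_apply]
  rw [h1, h2]
  constructor <;> ring

/-- With the force `y` frozen, the step solves `x'' = -lam i * x + z` exactly in each coordinate,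
where `z` is the coordinate of `y`. It rotates the pair `(√(lam i) * (a - z / lam i), b)` of shifted
displacement and velocity, so `lam i * (a - z / lam i)² + b²` is preserved. -/
lemma exponential_energy_balance (hlam : ∀ i, 0 < lam i) (hmono : Monotone lam) {τ : ℝ}
    {u u' : HdotOne e lam} {v G v' y : H}
    (h : ((u' : H), v') = waveGroup e lam τ ((u : H), v)
      + waveInv e lam (waveGroup e lam τ (0, y) - (0, y)) + waveGroup e lam τ (0, G)) :
    hdotNorm e lam u' ^ 2 + ‖v'‖ ^ 2
      = hdotNorm e lam u ^ 2 + ‖v + G‖ ^ 2 + 2 * inner ℝ y ((u' : H) - u) := by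
  refine energy_balance_of_coord hlam fun i => ?_
  obtain ⟨h1, h2⟩ := exponential_step_coord hlam hmono h i
  have hμ : 0 < √(lam i) := Real.sqrt_pos.2 (hlam i)
  have hl : lam i = √(lam i) ^ 2 := (Real.sq_sqrt (hlam i).le).symm
  have hcs := Real.sin_sq_add_cos_sq (τ * √(lam i))
  rw [h1, h2]
  generalize Real.cos (τ * √(lam i)) = c at *
  generalize Real.sin (τ * √(lam i)) = s at *
  generalize √(lam i) = μ at *
  rw [hl]
  generalize e.repr (u : H) i = a at *
  generalize e.repr (v + G) i = b at *
  generalize e.repr y i = z at *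
  have hμ' := hμ.ne'
  field_simp
  have hs : s ^ 2 = 1 - c ^ 2 := by linarith
  ring_nf
  simp only [hs]
  ring

/-- With `x = τ √(lam i)`, the bounds `1 - cos x ≤ x`, `|sin x| ≤ x` and `1 - cos x ≤ x²` extract
powers of `τ` from the multipliers. The first costs a factor `√(lam i)`, which is why the `Ḣ¹` norm
of `u` appears; the other two are compensated by the negative powers of `lam i`. -/
lemma norm_exponential_increment_le (hlam : ∀ i, 0 < lam i) (hmono : Monotone lam) {τ : ℝ}
    (hτ : 0 ≤ τ) {u u' : HdotOne e lam} {v G v' y : H}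
    (h : ((u' : H), v') = waveGroup e lam τ ((u : H), v)
      + waveInv e lam (waveGroup e lam τ (0, y) - (0, y)) + waveGroup e lam τ (0, G)) :
    ‖(u' : H) - u‖ ≤ τ * (hdotNorm e lam u + ‖v + G‖ + τ * ‖y‖) := by
  have hC : Memℓp (fun i => (Real.cos (τ * √(lam i)) - 1) * e.repr (u : H) i) 2 :=
    memlp_mul_of_bounded (C := 2) (fun i => by
      rw [abs_le]; constructor <;> linarith [Real.neg_one_le_cos (τ * √(lam i)),
        Real.cos_le_one (τ * √(lam i))]) _
  have key : ∀ i, |Real.cos (τ * √(lam i)) - 1| ≤ τ * √(lam i) ∧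
      |(√(lam i))⁻¹ * Real.sin (τ * √(lam i))| ≤ τ ∧
      |(lam i)⁻¹ * (1 - Real.cos (τ * √(lam i)))| ≤ τ ^ 2 := by
    intro i
    have hμ : 0 < √(lam i) := Real.sqrt_pos.2 (hlam i)
    have hx : 0 ≤ τ * √(lam i) := by positivity
    have hl : lam i = √(lam i) ^ 2 := (Real.sq_sqrt (hlam i).le).symm
    have hc := Real.one_sub_sq_div_two_le_cos (x := τ * √(lam i))
    have hc1 := Real.cos_le_one (τ * √(lam i))
    have hc2 := Real.neg_one_le_cos (τ * √(lam i))
    have hs := Real.abs_sin_le_abs (x := τ * √(lam i))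
    rw [abs_of_nonneg hx] at hs
    refine ⟨?_, ?_, ?_⟩
    · rw [abs_sub_comm, abs_of_nonneg (by linarith)]
      -- Below 2 use `1 - cos x ≤ x² / 2 ≤ x`; above 2 use `1 - cos x ≤ 2 ≤ x`.
      rcases le_total (τ * √(lam i)) 2 with h2 | h2
      · nlinarith
      · linarith
    · rw [abs_mul, abs_of_pos (inv_pos.2 hμ), inv_mul_le_iff₀ hμ]
      linarith
    · rw [abs_mul, abs_of_pos (inv_pos.2 (hlam i)), inv_mul_le_iff₀ (hlam i),
        abs_of_nonneg (by linarith)]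
      nlinarith
  have hS : ∀ x : H,
      Memℓp (fun i => (√(lam i))⁻¹ * Real.sin (τ * √(lam i)) * e.repr x i) 2 :=
    memlp_mul_of_bounded fun i => (key i).2.1
  have hL : ∀ x : H,
      Memℓp (fun i => (lam i)⁻¹ * (1 - Real.cos (τ * √(lam i))) * e.repr x i) 2 :=
    memlp_mul_of_bounded fun i => (key i).2.2
  have hsplit : (u' : H) - u = specOp e (fun i => Real.cos (τ * √(lam i)) - 1) (u : H)
      + specOp e (fun i => (√(lam i))⁻¹ * Real.sin (τ * √(lam i))) (v + G)
      + specOp e (fun i => (lam i)⁻¹ * (1 - Real.cos (τ * √(lam i)))) y := by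
    apply e.repr.injective
    ext i
    have h1 := (exponential_step_coord hlam hmono h i).1
    generalize v + G = w at h1 ⊢
    simp only [map_add, map_sub, lp.coeFn_add, lp.coeFn_sub, Pi.add_apply, Pi.sub_apply,
      repr_specOp hC, repr_specOp (hS _), repr_specOp (hL _)]
    rw [h1]
    ring
  have b1 : ‖specOp e (fun i => Real.cos (τ * √(lam i)) - 1) (u : H)‖
      ≤ τ * hdotNorm e lam u := by
    refine norm_le_of_coord (e := e) hτ fun i => ?_
    rw [repr_specOp hC, repr_specOp u.2, abs_mul, abs_mul, ← mul_assoc,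
      abs_of_nonneg (Real.sqrt_nonneg _)]
    exact mul_le_mul_of_nonneg_right (key i).1 (abs_nonneg _)
  have b2 : ‖specOp e (fun i => (√(lam i))⁻¹ * Real.sin (τ * √(lam i))) (v + G)‖
      ≤ τ * ‖v + G‖ := by
    refine norm_le_of_coord (e := e) hτ fun i => ?_
    rw [repr_specOp (hS _), abs_mul]
    exact mul_le_mul_of_nonneg_right (key i).2.1 (abs_nonneg _)
  have b3 : ‖specOp e (fun i => (lam i)⁻¹ * (1 - Real.cos (τ * √(lam i)))) y‖
      ≤ τ ^ 2 * ‖y‖ := by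
    refine norm_le_of_coord (e := e) (by positivity) fun i => ?_
    rw [repr_specOp (hL _), abs_mul]
    exact mul_le_mul_of_nonneg_right (key i).2.2 (abs_nonneg _)
  rw [hsplit]
  refine (norm_add₃_le).trans ?_
  linarith

end Spectral

/-! ### Gaussian sums in a Hilbert space -/

/-! ### Elementary inequalities for powers -/

section Elementary

/-- Jensen's inequality for the weights `v i`, multiplied out so that total weight zero is allowed.
-/
lemma sum_mul_pow_le {ι : Type*} (s : Finset ι) {v z : ι → ℝ} (hv : ∀ i, 0 ≤ v i)
    (hz : ∀ i, 0 ≤ z i) (n : ℕ) :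
    (∑ i ∈ s, v i * z i) ^ (n + 1) ≤ (∑ i ∈ s, v i) ^ n * ∑ i ∈ s, v i * z i ^ (n + 1) := by
  rcases (Finset.sum_nonneg fun i (_ : i ∈ s) => hv i).eq_or_lt with h | h
  · have h0 : ∀ i ∈ s, v i = 0 := (Finset.sum_eq_zero_iff_of_nonneg fun i _ => hv i).1 h.symm
    rw [Finset.sum_eq_zero (f := fun i => v i * z i) fun i hi => by simp [h0 i hi],
      zero_pow n.succ_ne_zero]
    exact mul_nonneg (pow_nonneg h.le _)
      (Finset.sum_nonneg fun i _ => mul_nonneg (hv i) (pow_nonneg (hz i) _))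
  · set V := ∑ i ∈ s, v i
    have := Real.pow_arith_mean_le_arith_mean_pow s (fun i => v i / V) z
      (fun i _ => div_nonneg (hv i) h.le) (by rw [← Finset.sum_div, div_self h.ne'])
      (fun i _ => hz i) (n + 1)
    simp only [div_mul_eq_mul_div, ← Finset.sum_div] at this
    rw [div_pow, div_le_div_iff₀ (by positivity) h] at this
    have h2 : (∑ i ∈ s, v i * z i) ^ (n + 1) * V
        ≤ (V ^ n * ∑ i ∈ s, v i * z i ^ (n + 1)) * V := by
      refine this.trans (le_of_eq ?_)
      ring
    exact le_of_mul_le_mul_right h2 h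

lemma abs_one_add_pow_sub_le (y : ℝ) (m : ℕ) :
    |(1 + y) ^ m - 1 - m * y| ≤ m ^ 2 * y ^ 2 * (1 + |y|) ^ m := by
  induction m with
  | zero => simp
  | succ m ih =>
    have h1 : (1 + y) ^ (m + 1) - 1 - ((m + 1 : ℕ) : ℝ) * y
        = (1 + y) * ((1 + y) ^ m - 1 - m * y) + m * y ^ 2 := by
      push_cast; ring
    have hy : |1 + y| ≤ 1 + |y| := by simpa using abs_add_le 1 y
    have h2 : 1 ≤ (1 + |y|) ^ (m + 1) := one_le_pow₀ (by linarith [abs_nonneg y])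
    rw [h1]
    calc |(1 + y) * ((1 + y) ^ m - 1 - m * y) + m * y ^ 2|
        ≤ (1 + |y|) * (m ^ 2 * y ^ 2 * (1 + |y|) ^ m) + m * y ^ 2 := by
          refine (abs_add_le _ _).trans (add_le_add ?_ (abs_of_nonneg (by positivity)).le)
          rw [abs_mul]
          gcongr
      _ ≤ m ^ 2 * y ^ 2 * (1 + |y|) ^ (m + 1) + m * y ^ 2 * (1 + |y|) ^ (m + 1) := by
          refine add_le_add (le_of_eq (by ring)) ?_
          exact le_mul_of_one_le_right (by positivity) h2
      _ ≤ ((m + 1 : ℕ) : ℝ) ^ 2 * y ^ 2 * (1 + |y|) ^ (m + 1) := by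
          rw [← add_mul, ← add_mul]
          gcongr
          push_cast
          nlinarith [(Nat.cast_nonneg m : (0 : ℝ) ≤ m)]

lemma one_add_pow_le {r : ℝ} (hr : 0 ≤ r) (n : ℕ) : (1 + r) ^ n ≤ 2 ^ n * (1 + r ^ n) := by
  rcases le_total r 1 with h | h
  · calc (1 + r) ^ n ≤ 2 ^ n := pow_le_pow_left₀ (by linarith) (by linarith) n
      _ ≤ 2 ^ n * (1 + r ^ n) := le_mul_of_one_le_right (by positivity) (by simp; positivity)
  · calc (1 + r) ^ n ≤ (2 * r) ^ n := pow_le_pow_left₀ (by linarith) (by linarith) n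
      _ ≤ 2 ^ n * (1 + r ^ n) := by rw [mul_pow]; gcongr; linarith

/-- Meant for `y` the relative change of energy and `r` the noise norm divided by the square root of
the energy. The linear term is kept exact, because part of it has mean zero. The remainder starts at
`r²`, of expectation `O(τ)`, and has only even powers of `r`. The hypothesis says that `1 + |y| ≤ (1
+ r)²`. -/
lemma one_add_pow_le_of_abs_le {y r : ℝ} (hr : 0 ≤ r) (hy : |y| ≤ r * (2 + r)) (m : ℕ) :
    (1 + y) ^ m ≤ 1 + m * y + 4 * m ^ 2 * 2 ^ (2 * m + 2) * (r ^ 2 + r ^ (2 * (m + 2))) := by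
  have h1 := (le_abs_self _).trans (abs_one_add_pow_sub_le y m)
  have h2 : y ^ 2 ≤ 4 * r ^ 2 * (1 + r) ^ 2 := by
    rw [← sq_abs]
    calc |y| ^ 2 ≤ (r * (2 + r)) ^ 2 := pow_le_pow_left₀ (abs_nonneg _) hy 2
      _ ≤ (r * (2 * (1 + r))) ^ 2 := by gcongr; linarith
      _ = _ := by ring
  have h3 : (1 + |y|) ^ m ≤ (1 + r) ^ (2 * m) := by
    rw [pow_mul]
    exact pow_le_pow_left₀ (by positivity) (by nlinarith) m
  have h4 : (m : ℝ) ^ 2 * y ^ 2 * (1 + |y|) ^ m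
      ≤ 4 * m ^ 2 * 2 ^ (2 * m + 2) * (r ^ 2 + r ^ (2 * (m + 2))) := by
    calc (m : ℝ) ^ 2 * y ^ 2 * (1 + |y|) ^ m
        ≤ m ^ 2 * (4 * r ^ 2 * (1 + r) ^ 2) * (1 + r) ^ (2 * m) := by gcongr
      _ = 4 * m ^ 2 * r ^ 2 * (1 + r) ^ (2 * m + 2) := by ring
      _ ≤ 4 * m ^ 2 * r ^ 2 * (2 ^ (2 * m + 2) * (1 + r ^ (2 * m + 2))) := by
          gcongr; exact one_add_pow_le hr _
      _ = _ := by ring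
  linarith

end Elementary

/-- The even moments of the standard Gaussian law. -/
noncomputable def gaussMoment (j : ℕ) : ℝ := ∫ x, x ^ (2 * j) ∂(gaussianReal 0 1)

lemma gaussMoment_nonneg (j : ℕ) : 0 ≤ gaussMoment j :=
  integral_nonneg fun x => by rw [pow_mul]; positivity

/-! ### Moments of Gaussian sums with vector coefficients -/

section Gaussian

variable {Ω : Type*} {mΩ : MeasurableSpace Ω} {P : Measure Ω}

lemma integrable_pow_gaussianReal (s : ℝ≥0) (j : ℕ) :
    Integrable (fun x : ℝ => x ^ j) (gaussianReal 0 s) := by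
  have h := (memLp_id_gaussianReal (μ := 0) (v := s) (j : ℝ≥0)).integrable_norm_pow'
  refine (integrable_norm_iff (by fun_prop)).1 ?_
  simpa [norm_pow] using h

lemma integrable_pow_of_hasLaw {Y : Ω → ℝ} {s : ℝ≥0} (h : HasLaw Y (gaussianReal 0 s) P) (j : ℕ) :
    Integrable (fun ω => Y ω ^ j) P := by
  have h1 := integrable_pow_gaussianReal s j
  rw [← h.map_eq, integrable_map_measure (by fun_prop) h.aemeasurable] at h1
  exact h1

lemma integral_even_pow_gaussianReal (s : ℝ≥0) (j : ℕ) :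
    ∫ x, x ^ (2 * j) ∂(gaussianReal 0 s) = (s : ℝ) ^ j * gaussMoment j := by
  have h : gaussianReal 0 s = (gaussianReal 0 1).map (fun x => √(s : ℝ) * x) := by
    rw [gaussianReal_map_const_mul, mul_zero, mul_one]
    congr 1
    ext
    simp
  rw [h, integral_map (by fun_prop) (by fun_prop)]
  simp only [mul_pow]
  rw [integral_const_mul, gaussMoment, pow_mul, Real.sq_sqrt s.coe_nonneg]

lemma hasLaw_gaussian_sum [IsProbabilityMeasure P] {ξ : ℕ → Ω → ℝ} {s : ℝ≥0}
    (hm : ∀ k, Measurable (ξ k)) (hlaw : ∀ k, HasLaw (ξ k) (gaussianReal 0 s) P)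
    (hind : iIndepFun ξ P) (c : ℕ → ℝ) (M : ℕ) :
    HasLaw (fun ω => ∑ k ∈ Finset.range M, ξ k ω * c k)
      (gaussianReal 0 (s * ∑ k ∈ Finset.range M, (‖c k‖₊) ^ 2)) P := by
  induction M with
  | zero =>
    refine ⟨by fun_prop, ?_⟩
    simp [gaussianReal_zero_var]
  | succ M ih =>
    have h1 : HasLaw (fun ω => ξ M ω * c M) (gaussianReal 0 (s * ‖c M‖₊ ^ 2)) P := by
      have := gaussianReal_mul_const (hlaw M) (c M)
      rw [mul_zero] at this
      convert this using 2
      rw [mul_comm]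
      congr 1
      ext
      simp
    have hind' : iIndepFun (fun k ω => ξ k ω * c k) P :=
      hind.comp (fun k x => x * c k) (fun k => by fun_prop)
    have h2 : IndepFun (fun ω => ∑ k ∈ Finset.range M, ξ k ω * c k) (fun ω => ξ M ω * c M) P := by
      have := hind'.indepFun_finsetSum_of_notMem (s := Finset.range M) (i := M)
        (fun k => (hm k).mul_const _) (by simp)
      convert this using 1
      ext ω
      simp
    have h3 := gaussianReal_add_gaussianReal_of_indepFun h2 ih.map_eq h1.map_eq
    refine ⟨by fun_prop, ?_⟩
    simp only [Finset.sum_range_succ, mul_add]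
    rw [add_zero] at h3
    exact h3

variable {H : Type*} [NormedAddCommGroup H] [InnerProductSpace ℝ H]

/-- In an orthonormal basis of the finite-dimensional span of the `s k`, each coordinate is a
centred real Gaussian of variance `t * v i`, and the `v i` sum to `∑ ‖s k‖²`. Jensen with weights `v
i` reduces the claim to one dimension, so the constant is a scalar Gaussian moment independent of
`M`. The coordinates need not be independent of each other. -/
lemma norm_gaussian_sum_pow [IsProbabilityMeasure P] {ξ : ℕ → Ω → ℝ} {t : ℝ≥0}
    (hm : ∀ k, Measurable (ξ k)) (hlaw : ∀ k, HasLaw (ξ k) (gaussianReal 0 t) P)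
    (hind : iIndepFun ξ P) (s : ℕ → H) (M j : ℕ) :
    Integrable (fun ω => ‖∑ k ∈ Finset.range M, ξ k ω • s k‖ ^ (2 * (j + 1))) P ∧
    ∫ ω, ‖∑ k ∈ Finset.range M, ξ k ω • s k‖ ^ (2 * (j + 1)) ∂P
      ≤ gaussMoment (j + 1) * (t * ∑ k ∈ Finset.range M, ‖s k‖ ^ 2) ^ (j + 1) := by
  let U := Submodule.span ℝ (s '' (Finset.range M : Set ℕ))
  have hfin : FiniteDimensional ℝ U := FiniteDimensional.span_of_finite ℝ
    ((Finset.range M).finite_toSet.image s)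
  have hsU : ∀ k ∈ Finset.range M, s k ∈ U := fun k hk => Submodule.subset_span ⟨k, hk, rfl⟩
  let b := stdOrthonormalBasis ℝ U
  have hb : ∀ x ∈ U, ∑ i, inner ℝ (b i : H) x ^ 2 = ‖x‖ ^ 2 := fun x hx => by
    simpa using b.sum_sq_norm_inner_right ⟨x, hx⟩
  set X : Ω → H := fun ω => ∑ k ∈ Finset.range M, ξ k ω • s k with hX
  have hXU : ∀ ω, X ω ∈ U := fun ω =>
    Submodule.sum_mem _ fun k hk => Submodule.smul_mem _ _ (hsU k hk)
  let c : Fin (Module.finrank ℝ U) → ℕ → ℝ := fun i k => inner ℝ (b i : H) (s k)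
  let y : Fin (Module.finrank ℝ U) → Ω → ℝ := fun i ω => ∑ k ∈ Finset.range M, ξ k ω * c i k
  let v : Fin (Module.finrank ℝ U) → ℝ≥0 := fun i => ∑ k ∈ Finset.range M, ‖c i k‖₊ ^ 2
  have hv : ∀ i, (v i : ℝ) = ∑ k ∈ Finset.range M, c i k ^ 2 := fun i => by simp [v]
  have hvsum : ∑ i, (v i : ℝ) = ∑ k ∈ Finset.range M, ‖s k‖ ^ 2 := by
    simp only [hv]
    rw [Finset.sum_comm]
    exact Finset.sum_congr rfl fun k hk => hb _ (hsU k hk)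
  have hXy : ∀ ω, ‖X ω‖ ^ 2 = ∑ i, y i ω ^ 2 := fun ω => by
    rw [← hb _ (hXU ω)]
    simp [hX, y, c, inner_sum, inner_smul_right]
  have hy0 : ∀ i ω, (v i : ℝ) = 0 → y i ω = 0 := by
    intro i ω h
    rw [hv, Finset.sum_eq_zero_iff_of_nonneg fun k _ => sq_nonneg _] at h
    exact Finset.sum_eq_zero fun k hk => by rw [pow_eq_zero_iff two_ne_zero |>.1 (h k hk), mul_zero]
  have hylaw : ∀ i, HasLaw (y i) (gaussianReal 0 (t * v i)) P := fun i =>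
    hasLaw_gaussian_sum hm hlaw hind (c i) M
  have hyint : ∀ i, Integrable (fun ω => y i ω ^ (2 * (j + 1))) P := fun i =>
    integrable_pow_of_hasLaw (hylaw i) _
  have hyval : ∀ i, ∫ ω, y i ω ^ (2 * (j + 1)) ∂P
      = ((t : ℝ) * v i) ^ (j + 1) * gaussMoment (j + 1) := fun i => by
    have := (hylaw i).integral_comp (f := fun x => x ^ (2 * (j + 1))) (by fun_prop)
    simp only [Function.comp_def] at this
    rw [this, integral_even_pow_gaussianReal]
    simp
  -- Write `‖X‖²` as the average of `y i ² / v i` with weights `v i`. Where `v i = 0`, the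
  -- coordinate `y i` vanishes by `hy0`.
  have hpt : ∀ ω, ‖X ω‖ ^ (2 * (j + 1)) ≤ (∑ i, (v i : ℝ)) ^ j *
      ∑ i, (v i : ℝ) * ((v i : ℝ)⁻¹ ^ (j + 1) * y i ω ^ (2 * (j + 1))) := fun ω => by
    have h1 : ‖X ω‖ ^ 2 = ∑ i, (v i : ℝ) * ((v i : ℝ)⁻¹ * y i ω ^ 2) := by
      rw [hXy]
      refine Finset.sum_congr rfl fun i _ => ?_
      by_cases h : (v i : ℝ) = 0
      · simp [h, hy0 i ω h]
      · field_simp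
    rw [pow_mul, h1]
    refine (sum_mul_pow_le _ (fun i => (v i).coe_nonneg) (fun i => by positivity) j).trans (le_of_eq ?_)
    simp only [mul_pow, pow_mul]
  have hint : Integrable (fun ω => (∑ i, (v i : ℝ)) ^ j *
      ∑ i, (v i : ℝ) * ((v i : ℝ)⁻¹ ^ (j + 1) * y i ω ^ (2 * (j + 1)))) P :=
    (integrable_finsetSum _ fun i _ => ((hyint i).const_mul _).const_mul _).const_mul _
  have hXm : AEStronglyMeasurable X P := by
    refine StronglyMeasurable.aestronglyMeasurable ?_
    exact Finset.stronglyMeasurable_fun_sum _ fun k _ => (hm k).stronglyMeasurable.smul_const _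
  have hXint : Integrable (fun ω => ‖X ω‖ ^ (2 * (j + 1))) P :=
    hint.mono' (hXm.norm.pow _) (ae_of_all _ fun ω => by
      rw [Real.norm_of_nonneg (by positivity)]; exact hpt ω)
  refine ⟨hXint, (integral_mono hXint hint hpt).trans ?_⟩
  rw [integral_const_mul, integral_finsetSum _ fun i _ => ((hyint i).const_mul _).const_mul _]
  simp only [integral_const_mul, hyval]
  rw [← hvsum, mul_pow, ← mul_assoc, mul_comm (gaussMoment _), pow_succ (∑ i, (v i : ℝ)) j,
    mul_comm ((∑ i, (v i : ℝ)) ^ j), mul_comm ((∑ i, (v i : ℝ)) ^ j)]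
  have hle : ∀ i, (v i : ℝ) * ((v i : ℝ)⁻¹ ^ (j + 1) * (((t : ℝ) * v i) ^ (j + 1)
      * gaussMoment (j + 1))) ≤ (t : ℝ) ^ (j + 1) * gaussMoment (j + 1) * v i := fun i => by
    by_cases h : (v i : ℝ) = 0
    · simp [h]
    · rw [mul_pow, inv_pow]
      field_simp
      rfl
  calc _ ≤ (∑ i, (t : ℝ) ^ (j + 1) * gaussMoment (j + 1) * v i) * (∑ i, (v i : ℝ)) ^ j := by
        exact mul_le_mul_of_nonneg_right (Finset.sum_le_sum fun i _ => hle i)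
          (pow_nonneg (Finset.sum_nonneg fun i _ => (v i).coe_nonneg) j)
    _ = _ := by rw [← Finset.mul_sum]; ring

lemma inner_gaussian_sum [IsProbabilityMeasure P] {ξ : ℕ → Ω → ℝ} {t : ℝ≥0}
    (hlaw : ∀ k, HasLaw (ξ k) (gaussianReal 0 t) P) (s : ℕ → H) (v : H) (M : ℕ) :
    Integrable (fun ω => inner ℝ v (∑ k ∈ Finset.range M, ξ k ω • s k)) P ∧
    ∫ ω, inner ℝ v (∑ k ∈ Finset.range M, ξ k ω • s k) ∂P = 0 := by
  have hi : ∀ k, Integrable (ξ k) P := fun k => by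
    simpa only [pow_one] using integrable_pow_of_hasLaw (hlaw k) 1
  have h0 : ∀ k, ∫ ω, ξ k ω ∂P = 0 := fun k => by
    rw [(hlaw k).integral_eq, integral_id_gaussianReal]
  simp only [inner_sum, inner_smul_right]
  refine ⟨integrable_finsetSum _ fun k _ => (hi k).mul_const _, ?_⟩
  rw [integral_finsetSum _ fun k _ => (hi k).mul_const _]
  simp [integral_mul_const, h0]

end Gaussian

/-! ### Moments of the energy after one noisy step -/

/-- The relative growth rate of the `m`-th moment of the energy over a step of length at most `T`,
when the squared Hilbert–Schmidt norm of the noise is at most `L` times the energy. -/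
noncomputable def stepRate (m : ℕ) (L T : ℝ) : ℝ :=
  (m / 2 + 4 * m ^ 2 * 2 ^ (2 * m + 2)) * (gaussMoment 1 * L)
    + 4 * m ^ 2 * 2 ^ (2 * m + 2) * (gaussMoment (m + 2) * L ^ (m + 2) * T ^ (m + 1))

lemma stepRate_nonneg (m : ℕ) {L T : ℝ} (hL : 0 ≤ L) (hT : 0 ≤ T) : 0 ≤ stepRate m L T := by
  have := gaussMoment_nonneg 1
  have := gaussMoment_nonneg (m + 2)
  unfold stepRate
  positivity

section Step

variable {Ω : Type*} {mΩ : MeasurableSpace Ω} {P : Measure Ω}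
  {H : Type*} [NormedAddCommGroup H] [InnerProductSpace ℝ H]

/-- The quantity equals `(W - ‖v‖² / 2) + ‖v + x‖² / 2`. -/
lemma energy_after_kick_nonneg {W : ℝ} {v : H} (hv : ‖v‖ ^ 2 ≤ 2 * W) (x : H) :
    0 ≤ W + inner ℝ v x + ‖x‖ ^ 2 / 2 := by
  have := norm_add_sq_real v x
  nlinarith [sq_nonneg ‖v + x‖]

/-- Dividing by `W` makes the estimate scale invariant: the variance relative to `W` is at most `L *
t`. The inner product integrates to zero, so every remaining term carries a factor `t`. -/
lemma lintegral_energy_pow_gaussian_sum_le [IsProbabilityMeasure P] {ξ : ℕ → Ω → ℝ} {t T : ℝ≥0}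
    (htT : t ≤ T) (hm : ∀ k, Measurable (ξ k)) (hlaw : ∀ k, HasLaw (ξ k) (gaussianReal 0 t) P)
    (hind : iIndepFun ξ P) (s : ℕ → H) (v : H) (M m : ℕ) {W L : ℝ} (hW : 0 < W)
    (hv : ‖v‖ ^ 2 ≤ 2 * W) (hs : ∑ k ∈ Finset.range M, ‖s k‖ ^ 2 ≤ L * W) :
    ∫⁻ ω, ENNReal.ofReal ((W + inner ℝ v (∑ k ∈ Finset.range M, ξ k ω • s k)
        + ‖∑ k ∈ Finset.range M, ξ k ω • s k‖ ^ 2 / 2) ^ m) ∂P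
      ≤ ENNReal.ofReal (1 + stepRate m L T * t) * ENNReal.ofReal (W ^ m) := by
  set X : Ω → H := fun ω => ∑ k ∈ Finset.range M, ξ k ω • s k with hX
  set K : ℝ := 4 * m ^ 2 * 2 ^ (2 * m + 2) with hK
  have hK0 : 0 ≤ K := by positivity
  have hsq : 0 < √W := Real.sqrt_pos.2 hW
  have hsq2 : √W ^ 2 = W := Real.sq_sqrt hW.le
  have hpow : ∀ x : ℝ, ∀ j : ℕ, (x / √W) ^ (2 * j) = (W ^ j)⁻¹ * x ^ (2 * j) := fun x j => by
    rw [div_pow, pow_mul (√W), hsq2, div_eq_inv_mul]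
  -- An integrable majorant of the relative energy's `m`-th power. The exponents are spelled to
  -- match `norm_gaussian_sum_pow` with `j = 0` and `j = m + 1`.
  let B : Ω → ℝ := fun ω => 1 + m * (W⁻¹ * (inner ℝ v (X ω) + ‖X ω‖ ^ (2 * (0 + 1)) / 2))
    + K * ((W ^ 1)⁻¹ * ‖X ω‖ ^ (2 * (0 + 1)) + (W ^ (m + 2))⁻¹ * ‖X ω‖ ^ (2 * (m + 1 + 1)))
  have hpt : ∀ ω, (W + inner ℝ v (X ω) + ‖X ω‖ ^ 2 / 2) ^ m ≤ W ^ m * B ω := fun ω => by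
    set y : ℝ := W⁻¹ * (inner ℝ v (X ω) + ‖X ω‖ ^ 2 / 2) with hy
    have h1 : W + inner ℝ v (X ω) + ‖X ω‖ ^ 2 / 2 = W * (1 + y) := by
      rw [hy]; field_simp; ring
    have hin : |inner ℝ v (X ω)| ≤ 2 * √W * ‖X ω‖ := by
      refine (abs_real_inner_le_norm v (X ω)).trans ?_
      refine mul_le_mul_of_nonneg_right ?_ (norm_nonneg _)
      refine abs_le_of_sq_le_sq' ?_ (by positivity) |>.2
      rw [mul_pow, hsq2]; linarith
    have h2 : |y| ≤ ‖X ω‖ / √W * (2 + ‖X ω‖ / √W) := by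
      have : ‖X ω‖ / √W * (2 + ‖X ω‖ / √W) = W⁻¹ * (2 * √W * ‖X ω‖ + ‖X ω‖ ^ 2) := by
        have hWr : W⁻¹ = (√W)⁻¹ ^ 2 := by rw [inv_pow, hsq2]
        rw [hWr]; field_simp
      rw [this, hy, abs_mul, abs_of_pos (inv_pos.2 hW)]
      refine mul_le_mul_of_nonneg_left ?_ (inv_pos.2 hW).le
      refine (abs_add_le _ _).trans (add_le_add hin ?_)
      rw [abs_of_nonneg (by positivity)]
      linarith [sq_nonneg ‖X ω‖]
    have h3 := one_add_pow_le_of_abs_le (by positivity) h2 m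
    rw [h1, mul_pow]
    refine mul_le_mul_of_nonneg_left (h3.trans (le_of_eq ?_)) (by positivity)
    have e1 : (‖X ω‖ / √W) ^ 2 = (W ^ 1)⁻¹ * ‖X ω‖ ^ (2 * 1) := hpow _ 1
    rw [e1, hpow]
  obtain ⟨hi1, he1⟩ := norm_gaussian_sum_pow hm hlaw hind s M 0
  obtain ⟨hi2, he2⟩ := norm_gaussian_sum_pow hm hlaw hind s M (m + 1)
  obtain ⟨hi3, he3⟩ := inner_gaussian_sum hlaw s v M
  have hib1 : Integrable (fun ω => m * (W⁻¹ * (inner ℝ v (X ω) + ‖X ω‖ ^ (2 * (0 + 1)) / 2))) P :=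
    ((hi3.add (hi1.div_const 2)).const_mul _).const_mul _
  have hib2 : Integrable (fun ω => K * ((W ^ 1)⁻¹ * ‖X ω‖ ^ (2 * (0 + 1))
      + (W ^ (m + 2))⁻¹ * ‖X ω‖ ^ (2 * (m + 1 + 1)))) P :=
    ((hi1.const_mul _).add (hi2.const_mul _)).const_mul _
  have hib0 : Integrable
      (fun ω => 1 + m * (W⁻¹ * (inner ℝ v (X ω) + ‖X ω‖ ^ (2 * (0 + 1)) / 2))) P :=
    (integrable_const _).add hib1
  have hBint : Integrable B P := hib0.add hib2
  have hBval : ∫ ω, B ω ∂P ≤ 1 + stepRate m L T * t := by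
    have hcalc : ∫ ω, B ω ∂P = 1 + m * (W⁻¹ * ((∫ ω, ‖X ω‖ ^ (2 * (0 + 1)) ∂P) / 2))
        + K * ((W ^ 1)⁻¹ * (∫ ω, ‖X ω‖ ^ (2 * (0 + 1)) ∂P)
          + (W ^ (m + 2))⁻¹ * (∫ ω, ‖X ω‖ ^ (2 * (m + 1 + 1)) ∂P)) := by
      simp only [B]
      rw [integral_add hib0 hib2, integral_add (integrable_const _) hib1,
        integral_const_mul, integral_const_mul, integral_const_mul,
        integral_add hi3 (hi1.div_const 2), he3, integral_div,
        integral_add (hi1.const_mul _) (hi2.const_mul _), integral_const_mul, integral_const_mul]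
      simp [X]
    set S := ∑ k ∈ Finset.range M, ‖s k‖ ^ 2 with hS
    have hS0 : 0 ≤ S := Finset.sum_nonneg fun k _ => sq_nonneg _
    have hSW : W⁻¹ * S ≤ L := by rw [inv_mul_le_iff₀ hW]; linarith
    have hL : 0 ≤ L := le_trans (by positivity) hSW
    have g1 := gaussMoment_nonneg 1
    have g2 := gaussMoment_nonneg (m + 2)
    have b1 : W⁻¹ * (∫ ω, ‖X ω‖ ^ (2 * (0 + 1)) ∂P) ≤ gaussMoment 1 * L * t := by
      calc _ ≤ W⁻¹ * (gaussMoment (0 + 1) * (t * S) ^ (0 + 1)) := by gcongr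
        _ = gaussMoment 1 * (W⁻¹ * S) * t := by ring
        _ ≤ _ := by gcongr
    -- Of the power `t ^ (m + 2)` one factor is kept, and the others are bounded by `T`.
    have b2 : (W ^ (m + 2))⁻¹ * (∫ ω, ‖X ω‖ ^ (2 * (m + 1 + 1)) ∂P)
        ≤ gaussMoment (m + 2) * L ^ (m + 2) * T ^ (m + 1) * t := by
      calc _ ≤ (W ^ (m + 2))⁻¹ * (gaussMoment (m + 1 + 1) * (t * S) ^ (m + 1 + 1)) := by gcongr
        _ = gaussMoment (m + 2) * (W⁻¹ * S) ^ (m + 2) * t ^ (m + 1) * t := by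
            rw [← inv_pow]; ring
        _ ≤ _ := by gcongr
    rw [hcalc]
    have e2 : (m : ℝ) * (W⁻¹ * ((∫ ω, ‖X ω‖ ^ (2 * (0 + 1)) ∂P) / 2))
        = m / 2 * (W⁻¹ * (∫ ω, ‖X ω‖ ^ (2 * (0 + 1)) ∂P)) := by ring
    rw [e2, pow_one]
    calc _ ≤ 1 + m / 2 * (gaussMoment 1 * L * t) + K * (gaussMoment 1 * L * t
          + gaussMoment (m + 2) * L ^ (m + 2) * T ^ (m + 1) * t) := by gcongr
      _ = 1 + stepRate m L T * t := by rw [stepRate, ← hK]; ring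
  have hB0 : ∀ ω, 0 ≤ W ^ m * B ω := fun ω =>
    (pow_nonneg (energy_after_kick_nonneg hv _) m).trans (hpt ω)
  calc _ ≤ ∫⁻ ω, ENNReal.ofReal (W ^ m * B ω) ∂P :=
        lintegral_mono fun ω => ENNReal.ofReal_le_ofReal (hpt ω)
    _ = ENNReal.ofReal (W ^ m * ∫ ω, B ω ∂P) := by
        rw [← ofReal_integral_eq_lintegral_ofReal (hBint.const_mul _) (ae_of_all _ hB0),
          integral_const_mul]
    _ ≤ ENNReal.ofReal ((1 + stepRate m L T * t) * W ^ m) := by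
        rw [mul_comm]
        gcongr
    _ = _ := ENNReal.ofReal_mul' (by positivity)

/-- Freezing: the joint law is a product, and Tonelli integrates out `Z` with `Y` fixed. It replaces
conditional expectations. -/
lemma lintegral_comp_indep [IsProbabilityMeasure P] {α β : Type*} [MeasurableSpace α]
    [MeasurableSpace β] {Y : Ω → α} {Z : Ω → β} (hY : Measurable Y) (hZ : Measurable Z)
    (hYZ : IndepFun Y Z P) {Φ : α × β → ℝ≥0∞} (hΦ : Measurable Φ) :
    ∫⁻ ω, Φ (Y ω, Z ω) ∂P = ∫⁻ ω, ∫⁻ ω', Φ (Y ω, Z ω') ∂P ∂P := by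
  have h := (indepFun_iff_map_prod_eq_prod_map_map hY.aemeasurable hZ.aemeasurable).1 hYZ
  have : IsProbabilityMeasure (P.map Y) := Measure.isProbabilityMeasure_map hY.aemeasurable
  have : IsProbabilityMeasure (P.map Z) := Measure.isProbabilityMeasure_map hZ.aemeasurable
  rw [← lintegral_map hΦ (hY.prodMk hZ), h, lintegral_prod _ hΦ.aemeasurable,
    lintegral_map hΦ.lintegral_prod_right' hY]
  refine lintegral_congr fun ω => ?_
  exact lintegral_map (hΦ.comp measurable_prodMk_left) hZ

/-- One step of the moment recursion for the energy. -/
lemma lintegral_energy_pow_step_le [IsProbabilityMeasure P] {α : Type*} [MeasurableSpace α]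
    {Y : Ω → α} (hY : Measurable Y) {ξ : ℕ → Ω → ℝ} {t T : ℝ≥0}
    (htT : t ≤ T) (hm : ∀ k, Measurable (ξ k)) (hlaw : ∀ k, HasLaw (ξ k) (gaussianReal 0 t) P)
    (hind : iIndepFun ξ P) (hYξ : IndepFun Y (fun ω k => ξ k ω) P)
    {s : ℕ → α → H} (hs : ∀ k, StronglyMeasurable (s k)) {v : α → H} (hv : StronglyMeasurable v)
    {W : α → ℝ} (hW : Measurable W) (hW0 : ∀ a, 0 < W a) (hvW : ∀ a, ‖v a‖ ^ 2 ≤ 2 * W a)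
    {L : ℝ} (hsW : ∀ M a, ∑ k ∈ Finset.range M, ‖s k a‖ ^ 2 ≤ L * W a) {G : Ω → H}
    (hG : TendstoInMeasure P (fun M ω => ∑ k ∈ Finset.range M, ξ k ω • s k (Y ω)) atTop G)
    (m : ℕ) :
    ∫⁻ ω, ENNReal.ofReal ((W (Y ω) + inner ℝ (v (Y ω)) (G ω) + ‖G ω‖ ^ 2 / 2) ^ m) ∂P
      ≤ ENNReal.ofReal (1 + stepRate m L T * t) * ∫⁻ ω, ENNReal.ofReal (W (Y ω) ^ m) ∂P := by
  obtain ⟨ns, -, hns⟩ := hG.exists_seq_tendsto_ae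
  let Φ : ℕ → α × (ℕ → ℝ) → ℝ≥0∞ := fun M z => ENNReal.ofReal
    ((W z.1 + inner ℝ (v z.1) (∑ k ∈ Finset.range M, z.2 k • s k z.1)
      + ‖∑ k ∈ Finset.range M, z.2 k • s k z.1‖ ^ 2 / 2) ^ m)
  have hΦ : ∀ M, Measurable (Φ M) := fun M => by
    have hX : StronglyMeasurable fun z : α × (ℕ → ℝ) => ∑ k ∈ Finset.range M, z.2 k • s k z.1 :=
      Finset.stronglyMeasurable_fun_sum _ fun k _ =>
        ((measurable_pi_apply k).comp measurable_snd).stronglyMeasurable.smul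
          ((hs k).comp_measurable measurable_fst)
    have h1 := ((hv.comp_measurable (measurable_fst (β := ℕ → ℝ))).inner hX (𝕜 := ℝ)).measurable
    have h2 := hX.norm.measurable
    exact ((((hW.comp measurable_fst).add h1).add ((h2.pow_const 2).div_const 2)).pow_const
      m).ennreal_ofReal
  have hξ : Measurable fun ω k => ξ k ω := measurable_pi_lambda _ hm
  have hM : ∀ M, ∫⁻ ω, Φ M (Y ω, fun k => ξ k ω) ∂P
      ≤ ENNReal.ofReal (1 + stepRate m L T * t) * ∫⁻ ω, ENNReal.ofReal (W (Y ω) ^ m) ∂P := by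
    intro M
    -- Once the past `Y` is frozen, the noise coefficients are deterministic and the Gaussian
    -- estimate applies.
    rw [lintegral_comp_indep hY hξ hYξ (hΦ M), ← lintegral_const_mul' _ _ ENNReal.ofReal_ne_top]
    exact lintegral_mono fun ω => lintegral_energy_pow_gaussian_sum_le htT hm hlaw hind
      (fun k => s k (Y ω)) (v (Y ω)) M m (hW0 _) (hvW _) (hsW M _)
  have hlim : ∀ᵐ ω ∂P, ENNReal.ofReal ((W (Y ω) + inner ℝ (v (Y ω)) (G ω) + ‖G ω‖ ^ 2 / 2) ^ m)
      = liminf (fun i => Φ (ns i) (Y ω, fun k => ξ k ω)) atTop := by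
    filter_upwards [hns] with ω hω
    have hc : Continuous fun x : H =>
        ENNReal.ofReal ((W (Y ω) + inner ℝ (v (Y ω)) x + ‖x‖ ^ 2 / 2) ^ m) :=
      ENNReal.continuous_ofReal.comp (by fun_prop)
    exact ((hc.tendsto _).comp hω).liminf_eq.symm
  rw [lintegral_congr_ae hlim]
  -- Fatou along an almost surely convergent subsequence passes from partial sums, whose bound is
  -- uniform in `M`, to `G`.
  refine (lintegral_liminf_le fun i => (hΦ (ns i)).comp (hY.prodMk hξ)).trans ?_
  exact liminf_le_of_le (by isBoundedDefault) fun b hb => by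
    obtain ⟨i, hi⟩ := hb.exists
    exact hi.trans (hM _)

end Step

/-! ### Measurability of locally Lipschitz maps on `Ḣ¹` -/

section HdotMeasurable

variable {H : Type*} [NormedAddCommGroup H] [InnerProductSpace ℝ H] {e : HilbertBasis ℕ ℝ H}
  {lam : ℕ → ℝ}

/-- `(-Λ)^{1/2}` as a linear map on `Ḣ¹`. -/
noncomputable def sqrtOp (e : HilbertBasis ℕ ℝ H) (lam : ℕ → ℝ) : HdotOne e lam →ₗ[ℝ] H where
  toFun u := specOp e (fun i => √(lam i)) (u : H)
  map_add' u w := by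
    apply e.repr.injective
    ext i
    rw [repr_specOp (u + w).2, map_add]
    simp only [lp.coeFn_add, Pi.add_apply, repr_specOp u.2, repr_specOp w.2, Submodule.coe_add,
      map_add]
    ring
  map_smul' c u := by
    apply e.repr.injective
    ext i
    rw [repr_specOp (c • u).2, map_smul]
    simp only [lp.coeFn_smul, Pi.smul_apply, repr_specOp u.2, Submodule.coe_smul, map_smul,
      smul_eq_mul, RingHom.id_apply]
    ring

lemma repr_sqrtOp (u : HdotOne e lam) (i : ℕ) :
    e.repr (sqrtOp e lam u) i = √(lam i) * e.repr (u : H) i := repr_specOp u.2 i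

lemma norm_sqrtOp (u : HdotOne e lam) : ‖sqrtOp e lam u‖ = hdotNorm e lam u := rfl

lemma hdotNorm_smul (c : ℝ) (u : HdotOne e lam) :
    hdotNorm e lam (c • u) = |c| * hdotNorm e lam u := by
  simp only [← norm_sqrtOp, map_smul, norm_smul, Real.norm_eq_abs]

lemma hdotNorm_sub_le (u w : HdotOne e lam) :
    hdotNorm e lam (u - w) ≤ hdotNorm e lam u + hdotNorm e lam w := by
  simp only [← norm_sqrtOp, map_sub]
  exact norm_sub_le _ _

lemma basis_mem_hdotOne (i : ℕ) : e i ∈ HdotOne e lam := by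
  show Memℓp (fun j => √(lam j) * e.repr (e i) j) 2
  rw [memlp_two_iff]
  refine summable_of_ne_finset_zero (s := {i}) fun j hj => ?_
  rw [e.repr_self, lp.single_apply_ne _ _ _ (by simpa using hj)]
  simp

/-- A basis vector as an element of `Ḣ¹`. -/
noncomputable def hdotBasis (e : HilbertBasis ℕ ℝ H) (lam : ℕ → ℝ) (i : ℕ) : HdotOne e lam :=
  ⟨e i, basis_mem_hdotOne i⟩

lemma sqrtOp_hdotBasis (i : ℕ) : sqrtOp e lam (hdotBasis e lam i) = √(lam i) • e i := by
  apply e.repr.injective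
  ext j
  rw [repr_sqrtOp, map_smul]
  show √(lam j) * e.repr (e i) j = _
  rw [lp.coeFn_smul, Pi.smul_apply, e.repr_self, smul_eq_mul]
  by_cases h : j = i
  · rw [h]
  · rw [lp.single_apply_ne _ _ _ h]; simp

lemma tendsto_sqrtOp_partialSum (u : HdotOne e lam) :
    Tendsto (fun m => sqrtOp e lam (∑ i ∈ Finset.range m, e.repr (u : H) i • hdotBasis e lam i))
      atTop (𝓝 (sqrtOp e lam u)) := by
  convert (e.hasSum_repr (sqrtOp e lam u)).tendsto_sum_nat using 2 with m
  rw [map_sum]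
  refine Finset.sum_congr rfl fun i _ => ?_
  rw [map_smul, sqrtOp_hdotBasis, repr_sqrtOp, smul_smul, mul_comm]

/-- As a submodule, `HdotOne` carries the `L²` topology. Convergence in `Ḣ¹` is therefore expressed
through `sqrtOp`. -/
lemma tendsto_of_locally_lipschitz {E : Type*} [NormedAddCommGroup E] {S : HdotOne e lam → E}
    {b : MvPolynomial (Fin 2) ℝ}
    (hS : ∀ u w, ‖S u - S w‖ ≤
      MvPolynomial.eval ![hdotNorm e lam u, hdotNorm e lam w] b * hdotNorm e lam (u - w))
    {ι : Type*} {l : Filter ι} {w : ι → HdotOne e lam} {u : HdotOne e lam}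
    (h : Tendsto (fun i => sqrtOp e lam (w i)) l (𝓝 (sqrtOp e lam u))) :
    Tendsto (fun i => S (w i)) l (𝓝 (S u)) := by
  rw [tendsto_iff_norm_sub_tendsto_zero]
  have h1 : Tendsto (fun i => hdotNorm e lam (w i - u)) l (𝓝 0) := by
    simpa only [← norm_sqrtOp, map_sub] using tendsto_iff_norm_sub_tendsto_zero.1 h
  have h2 : Tendsto (fun i => hdotNorm e lam (w i)) l (𝓝 (hdotNorm e lam u)) := h.norm
  have h3 : Continuous fun x : ℝ => MvPolynomial.eval ![x, hdotNorm e lam u] b := by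
    refine (MvPolynomial.continuous_eval b).comp ?_
    refine continuous_pi fun i => ?_
    fin_cases i
    · exact continuous_id
    · exact continuous_const
  have h4 := ((h3.tendsto _).comp h2).mul h1
  rw [mul_zero] at h4
  exact squeeze_zero (fun i => norm_nonneg _) (fun i => hS _ _) h4

/-- Here `u` is measurable only as an `L²`-valued map, while `S` is continuous only for the `Ḣ¹`
norm. Spectral truncations bridge the gap: they depend continuously on finitely many measurable
coefficients and converge to `u` in `Ḣ¹`. -/
lemma stronglyMeasurable_of_locally_lipschitz {E : Type*} [NormedAddCommGroup E]
    {S : HdotOne e lam → E} {b : MvPolynomial (Fin 2) ℝ}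
    (hS : ∀ u w, ‖S u - S w‖ ≤
      MvPolynomial.eval ![hdotNorm e lam u, hdotNorm e lam w] b * hdotNorm e lam (u - w))
    {α : Type*} [MeasurableSpace α] {u : α → HdotOne e lam}
    (hu : StronglyMeasurable fun a => (u a : H)) : StronglyMeasurable fun a => S (u a) := by
  refine stronglyMeasurable_of_tendsto atTop (f := fun m a =>
    S (∑ i ∈ Finset.range m, e.repr (u a : H) i • hdotBasis e lam i)) (fun m => ?_)
    (tendsto_pi_nhds.2 fun a => tendsto_of_locally_lipschitz hS (tendsto_sqrtOp_partialSum _))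
  let ψ : (Fin m → ℝ) → E := fun c => S (∑ i, c i • hdotBasis e lam i)
  have hψ : Continuous ψ := continuous_iff_continuousAt.2 fun c =>
    tendsto_of_locally_lipschitz hS (by
      have : Continuous fun c : Fin m → ℝ => sqrtOp e lam (∑ i, c i • hdotBasis e lam i) := by
        simp only [map_sum, map_smul]
        fun_prop
      exact this.tendsto c)
  have hc : Measurable fun a => fun i : Fin m => e.repr (u a : H) i := by
    refine measurable_pi_lambda _ fun i => ?_
    simp only [e.repr_apply_apply]
    exact ((stronglyMeasurable_const (b := e i)).inner hu (𝕜 := ℝ)).measurable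
  have := hψ.comp_stronglyMeasurable hc.stronglyMeasurable
  convert this using 2 with a
  simp only [ψ, Finset.sum_range]

lemma measurable_hdotNorm {α : Type*} [MeasurableSpace α] {u : α → HdotOne e lam}
    (hu : StronglyMeasurable fun a => (u a : H)) : Measurable fun a => hdotNorm e lam (u a) :=
  (stronglyMeasurable_of_locally_lipschitz (S := sqrtOp e lam) (b := 1) (fun u w => by
    rw [← map_sub, norm_sqrtOp]; simp) hu).norm.measurable

end HdotMeasurable

/-! ### Hilbert–Schmidt norms -/

section HS

variable {H : Type*} [NormedAddCommGroup H] [InnerProductSpace ℝ H] {e : HilbertBasis ℕ ℝ H}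
  {R : H →L[ℝ] H}

lemma sum_norm_compSqrt_sq_le {S : NoiseOp R}
    (hS : Summable fun k => ‖S.compSqrt (e k)‖ ^ 2) (M : ℕ) :
    ∑ k ∈ Finset.range M, ‖S.compSqrt (e k)‖ ^ 2 ≤ hsNorm e S ^ 2 := by
  rw [hsNorm, Real.sq_sqrt (tsum_nonneg fun k => sq_nonneg _)]
  exact hS.sum_le_tsum _ fun k _ => sq_nonneg _

/-- Summability for the difference is essential: without it the `tsum` inside `hsNorm` would take
the default value 0. -/
lemma norm_compSqrt_sub_le {S S' : NoiseOp R} (hS : IsHilbertSchmidt e S)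
    (hS' : IsHilbertSchmidt e S') (k : ℕ) :
    ‖S.compSqrt (e k) - S'.compSqrt (e k)‖ ≤ hsNorm e (S - S') := by
  have hsub : ∀ k, (S - S').compSqrt (e k) = S.compSqrt (e k) - S'.compSqrt (e k) := fun k => rfl
  have hsum : Summable fun k => ‖(S - S').compSqrt (e k)‖ ^ 2 := by
    refine Summable.of_nonneg_of_le (fun k => sq_nonneg _) (fun k => ?_)
      ((hS.2.mul_left 2).add (hS'.2.mul_left 2))
    rw [hsub]
    have := norm_sub_le (S.compSqrt (e k)) (S'.compSqrt (e k))
    nlinarith [norm_nonneg (S.compSqrt (e k) - S'.compSqrt (e k)),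
      sq_nonneg (‖S.compSqrt (e k)‖ - ‖S'.compSqrt (e k)‖)]
  rw [← hsub, hsNorm]
  exact Real.le_sqrt_of_sq_le (hsum.le_tsum k fun _ _ => sq_nonneg _)

end HS

/-! ### Brownian increments -/

section Brownian

variable {Ω : Type*} {mΩ : MeasurableSpace Ω} {P : Measure Ω} {ℱ : Filtration ℝ≥0 mΩ}
  {β : ℕ → ℝ≥0 → Ω → ℝ}

lemma IsBrownianSequence.measurable_increment (h : IsBrownianSequence P ℱ β) (s t : ℝ≥0) (k : ℕ) :
    Measurable fun ω => β k t ω - β k s ω :=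
  (((h.adapted k t).mono (ℱ.le t)).sub ((h.adapted k s).mono (ℱ.le s))).measurable

lemma IsBrownianSequence.hasLaw_increment (h : IsBrownianSequence P ℱ β) (s r : ℝ≥0) (k : ℕ) :
    HasLaw (fun ω => β k (s + r) ω - β k s ω) (gaussianReal 0 r) P := by
  have := (h.brownian k).toIsPreBrownianReal.hasLaw_sub (s + r) s
  have hd : nndist (s + r).1 s.1 = r := by
    ext
    rw [coe_nndist, Real.dist_eq]
    simp
  rwa [hd] at this

lemma IsBrownianSequence.iIndepFun_increment (h : IsBrownianSequence P ℱ β) (s t : ℝ≥0) :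
    iIndepFun (fun k ω => β k t ω - β k s ω) P :=
  h.indep.comp (fun _ (x : ℝ≥0 → ℝ) => x t - x s) (fun _ => by fun_prop)

/-- The past is encoded as the identity map into `Ω` with the σ-algebra `ℱ s`, so that independence
of the past becomes independence of two maps. -/
lemma IsBrownianSequence.indepFun_past (h : IsBrownianSequence P ℱ β) {s t : ℝ≥0} (hst : s ≤ t) :
    @IndepFun Ω Ω (ℕ → ℝ) mΩ (ℱ s) _ id (fun ω k => β k t ω - β k s ω) P := by
  refine (@IndepFun_iff_Indep Ω Ω (ℕ → ℝ) mΩ (ℱ s) _ id _ P).2 ?_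
  rw [MeasurableSpace.comap_id]
  exact (h.indep_past s t hst).symm

end Brownian

/-! ### Growth of polynomials and of the potential -/

lemma exists_polynomial_bound (b : Polynomial ℝ) {n : ℕ} (hn : b.natDegree ≤ n) :
    ∃ B : ℝ, 0 ≤ B ∧ ∀ x : ℝ, 0 ≤ x → b.eval x ≤ B * (1 + x) ^ n := by
  refine ⟨∑ i ∈ Finset.range (b.natDegree + 1), |b.coeff i|,
    Finset.sum_nonneg fun i _ => abs_nonneg _, fun x hx => ?_⟩
  rw [Polynomial.eval_eq_sum_range, Finset.sum_mul]
  refine Finset.sum_le_sum fun i hi => ?_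
  refine (mul_le_mul_of_nonneg_right (le_abs_self _) (pow_nonneg hx i)).trans ?_
  refine mul_le_mul_of_nonneg_left ?_ (abs_nonneg _)
  have hi' : i ≤ n := (Nat.lt_succ_iff.1 (Finset.mem_range.1 hi)).trans hn
  exact (pow_le_pow_left₀ hx (by linarith) i).trans (pow_le_pow_right₀ (by linarith) hi')

lemma IsConvexPolygonalDomain.isFiniteMeasure {d : ℕ} {O : Set (Pt d)}
    (hO : IsConvexPolygonalDomain O) :
    IsFiniteMeasure ((volume : Measure (Pt d)).restrict O) := by
  obtain ⟨-, s, rfl⟩ := hO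
  refine ⟨?_⟩
  rw [Measure.restrict_apply_univ]
  exact (measure_mono interior_subset).trans_lt
    (s.finite_toSet.isCompact_convexHull (𝕜 := ℝ)).measure_lt_top

/-- The increment of a differentiable function is bounded by the integral of the absolute value of
its derivative, whether or not the latter is finite. -/
lemma enorm_le_add_lintegral_deriv {Ft : ℝ → ℝ} (hF : Differentiable ℝ Ft) (a : ℝ) :
    ‖Ft a‖ₑ ≤ ‖Ft 0‖ₑ + ∫⁻ s in Set.Ioc (0 : ℝ) 1, ‖deriv Ft (s * a) * a‖ₑ := by
  -- An infinite integral leaves nothing to prove; a finite one makes the derivative integrable, as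
  -- the fundamental theorem of calculus requires.
  by_cases hfin : ∫⁻ s in Set.Ioc (0 : ℝ) 1, ‖deriv Ft (s * a) * a‖ₑ = ∞
  · rw [hfin, add_top]; exact le_top
  have hint : IntervalIntegrable (fun s => deriv Ft (s * a) * a) volume 0 1 := by
    rw [intervalIntegrable_iff_integrableOn_Ioc_of_le zero_le_one]
    refine ⟨?_, lt_top_iff_ne_top.2 hfin⟩
    exact (((measurable_deriv Ft).comp (measurable_id.mul_const a)).mul_const a).aestronglyMeasurable
  have hftc := intervalIntegral.integral_eq_sub_of_hasDerivAt (f := fun s => Ft (s * a))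
    (fun s _ => by
      have h1 : HasDerivAt (fun s : ℝ => s * a) a s := by simpa using (hasDerivAt_id s).mul_const a
      exact (hF (s * a)).hasDerivAt.comp s h1) hint
  rw [one_mul, zero_mul] at hftc
  have hdec : Ft a = Ft 0 + ∫ s in Set.Ioc (0 : ℝ) 1, deriv Ft (s * a) * a := by
    rw [← intervalIntegral.integral_of_le zero_le_one, hftc]; ring
  rw [hdec]
  exact (enorm_add_le _ _).trans (add_le_add le_rfl (enorm_integral_le_lintegral_enorm _))

lemma lintegral_enorm_mul_le {α : Type*} [MeasurableSpace α] {μ : Measure α} (φ ψ : Lp ℝ 2 μ) :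
    ∫⁻ x, ‖φ x * ψ x‖ₑ ∂μ ≤ ‖φ‖ₑ * ‖ψ‖ₑ := by
  have := eLpNorm_smul_le_mul_eLpNorm (p := 2) (q := 2) (r := 1) (Lp.aestronglyMeasurable ψ)
    (Lp.aestronglyMeasurable φ)
  rw [eLpNorm_one_eq_lintegral_enorm] at this
  simpa [Lp.enorm_def] using this

/-- Integrate `F̃'(s u) u = f(s u) u` over `s ∈ (0, 1]`, exchange the integrals, and apply
Cauchy–Schwarz, the growth of `f` and Poincaré's inequality. The bound is needed for the moments of
`q 0 ^ 2 = F(u₀) + δ₀`. -/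
lemma SuperlinearAssumption.potential_le {d : ℕ} {O : Set (Pt d)}
    (hO : IsConvexPolygonalDomain O) {lam : ℕ → ℝ} {e : HilbertBasis ℕ ℝ (L2 O)}
    (he : IsDirichletEigenbasis O lam e) {R : L2 O →L[ℝ] L2 O} {k : ℕ} {delta0 : ℝ} {Ft : ℝ → ℝ}
    {f : HdotOne e lam → L2 O} {g : HdotOne e lam → (Fin d → L2 O) → NoiseOp R}
    (hfg : SuperlinearAssumption O lam e R k delta0 Ft f g) :
    ∃ C : ℝ, 0 ≤ C ∧ ∀ u : HdotOne e lam,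
      potential O Ft (u : L2 O) ≤ C * (1 + hdotNorm e lam u) ^ (2 * k + 2) := by
  obtain ⟨b, hb, hf⟩ := hfg.f_growth
  obtain ⟨B, hB0, hB⟩ := exists_polynomial_bound b hb
  have hfin := hO.isFiniteMeasure
  set μ := (volume : Measure (Pt d)).restrict O with hμ
  refine ⟨|Ft 0| * μ.real Set.univ + B * (√(lam 0))⁻¹, by positivity, fun u => ?_⟩
  set h := hdotNorm e lam u with hh
  have h0 : 0 ≤ h := hdotNorm_nonneg u
  have hu : ‖(u : L2 O)‖ ≤ (√(lam 0))⁻¹ * h := norm_le_hdotNorm he.pos he.mono u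
  have hum : Measurable fun x => (u : L2 O) x := (Lp.stronglyMeasurable (u : L2 O)).measurable
  have hslice : ∀ s ∈ Set.Ioc (0 : ℝ) 1,
      ∫⁻ x, ‖deriv Ft (s * (u : L2 O) x) * (u : L2 O) x‖ₑ ∂μ
        ≤ ENNReal.ofReal (B * (1 + h) ^ (2 * k + 1) * ((√(lam 0))⁻¹ * h)) := by
    intro s hs
    have hfs : (f (s • u) : Pt d → ℝ) =ᵐ[μ] fun x => deriv Ft (s * (u : L2 O) x) := by
      filter_upwards [hfg.f_eq (s • u), Lp.coeFn_smul s (u : L2 O)] with x h1 h2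
      rw [h1, Submodule.coe_smul, h2, Pi.smul_apply, smul_eq_mul]
    calc _ = ∫⁻ x, ‖f (s • u) x * (u : L2 O) x‖ₑ ∂μ :=
          lintegral_congr_ae (by filter_upwards [hfs] with x hx; rw [hx])
      _ ≤ ‖f (s • u)‖ₑ * ‖(u : L2 O)‖ₑ := lintegral_enorm_mul_le _ _
      _ = ENNReal.ofReal (‖f (s • u)‖ * ‖(u : L2 O)‖) := by
          rw [ENNReal.ofReal_mul (norm_nonneg _), ofReal_norm, ofReal_norm]
      _ ≤ _ := by
          have hsh : hdotNorm e lam (s • u) ≤ h := by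
            rw [hdotNorm_smul, abs_of_pos hs.1]
            exact mul_le_of_le_one_left h0 hs.2
          have : ‖f (s • u)‖ ≤ B * (1 + h) ^ (2 * k + 1) := by
            refine (hf _).trans ((hB _ (hdotNorm_nonneg _)).trans ?_)
            have := hdotNorm_nonneg (s • u)
            gcongr
          gcongr
  have hmeas : Measurable fun z : Pt d × ℝ => ‖deriv Ft (z.2 * (u : L2 O) z.1) * (u : L2 O) z.1‖ₑ :=
    (((measurable_deriv Ft).comp (measurable_snd.mul (hum.comp measurable_fst))).mul
      (hum.comp measurable_fst)).enorm
  have hmain : ∫⁻ x, ‖Ft ((u : L2 O) x)‖ₑ ∂μ ≤ ENNReal.ofReal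
      (|Ft 0| * μ.real Set.univ + B * (1 + h) ^ (2 * k + 1) * ((√(lam 0))⁻¹ * h)) := by
    calc ∫⁻ x, ‖Ft ((u : L2 O) x)‖ₑ ∂μ
        ≤ ∫⁻ x, (‖Ft 0‖ₑ + ∫⁻ s in Set.Ioc (0 : ℝ) 1,
            ‖deriv Ft (s * (u : L2 O) x) * (u : L2 O) x‖ₑ) ∂μ :=
          lintegral_mono fun x => enorm_le_add_lintegral_deriv hfg.Ft_differentiable _
      _ = ‖Ft 0‖ₑ * μ Set.univ + ∫⁻ s in Set.Ioc (0 : ℝ) 1,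
            ∫⁻ x, ‖deriv Ft (s * (u : L2 O) x) * (u : L2 O) x‖ₑ ∂μ := by
          rw [lintegral_add_left measurable_const, lintegral_const,
            lintegral_lintegral_swap hmeas.aemeasurable]
      _ ≤ ‖Ft 0‖ₑ * μ Set.univ + ∫⁻ s in Set.Ioc (0 : ℝ) 1,
            ENNReal.ofReal (B * (1 + h) ^ (2 * k + 1) * ((√(lam 0))⁻¹ * h)) := by
          exact add_le_add le_rfl (setLIntegral_mono measurable_const hslice)
      _ = _ := by
          rw [setLIntegral_const, Real.volume_Ioc, sub_zero,
            ENNReal.ofReal_one, mul_one, ENNReal.ofReal_add (by positivity) (by positivity),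
            ENNReal.ofReal_mul (abs_nonneg _), ofReal_measureReal, ← Real.norm_eq_abs,
            ofReal_norm]
  have hle : potential O Ft (u : L2 O)
      ≤ |Ft 0| * μ.real Set.univ + B * (1 + h) ^ (2 * k + 1) * ((√(lam 0))⁻¹ * h) := by
    refine (le_abs_self _).trans ?_
    rw [← Real.norm_eq_abs, potential]
    refine (norm_integral_le_lintegral_norm _).trans ?_
    refine ENNReal.toReal_le_of_le_ofReal (by positivity) ?_
    simpa only [ofReal_norm] using hmain
  refine hle.trans ?_
  rw [add_mul]
  have h1 : 1 ≤ (1 + h) ^ (2 * k + 2) := one_le_pow₀ (by linarith)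
  refine add_le_add (le_mul_of_one_le_right (by positivity) h1) ?_
  calc B * (1 + h) ^ (2 * k + 1) * ((√(lam 0))⁻¹ * h)
      ≤ B * (1 + h) ^ (2 * k + 1) * ((√(lam 0))⁻¹ * (1 + h)) := by gcongr; linarith
    _ = _ := by ring

/-! ### The modified energy along a numerical solution -/

section Energy

variable {H : Type*} [NormedAddCommGroup H] [InnerProductSpace ℝ H] {e : HilbertBasis ℕ ℝ H}
  {lam : ℕ → ℝ}

/-- The modified energy of the scalar auxiliary variable schemes, shifted by one. -/
noncomputable def savEnergy (e : HilbertBasis ℕ ℝ H) (lam : ℕ → ℝ) (u : HdotOne e lam) (v : H)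
    (q : ℝ) : ℝ :=
  1 + hdotNorm e lam u ^ 2 / 2 + ‖v‖ ^ 2 / 2 + q ^ 2

lemma one_le_savEnergy (u : HdotOne e lam) (v : H) (q : ℝ) : 1 ≤ savEnergy e lam u v q := by
  unfold savEnergy; nlinarith [sq_nonneg (hdotNorm e lam u), sq_nonneg ‖v‖, sq_nonneg q]

lemma hdotNorm_le_savEnergy (u : HdotOne e lam) (v : H) (q : ℝ) :
    hdotNorm e lam u ≤ 2 * savEnergy e lam u v q := by
  unfold savEnergy
  nlinarith [sq_nonneg (hdotNorm e lam u - 1), sq_nonneg ‖v‖, sq_nonneg q]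

lemma norm_le_savEnergy (u : HdotOne e lam) (v : H) (q : ℝ) :
    ‖v‖ ≤ 2 * savEnergy e lam u v q := by
  unfold savEnergy
  nlinarith [sq_nonneg (hdotNorm e lam u), sq_nonneg (‖v‖ - 1), sq_nonneg q]

lemma abs_le_savEnergy (u : HdotOne e lam) (v : H) (q : ℝ) : |q| ≤ savEnergy e lam u v q := by
  unfold savEnergy
  nlinarith [sq_nonneg (hdotNorm e lam u), sq_nonneg ‖v‖, sq_abs q, sq_nonneg (|q| - 1)]

/-- The energy after one step, when the step of `(u, v)` after the noise has been added to `v`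
balances the work done by the drift `-(q + q') / 2 • F`. -/
lemma savEnergy_step {u u' : HdotOne e lam} {v G v' F : H} {q q' : ℝ}
    (hq : q' = q + 1 / 2 * inner ℝ F ((u' : H) - u))
    (hbal : hdotNorm e lam u' ^ 2 + ‖v'‖ ^ 2 = hdotNorm e lam u ^ 2 + ‖v + G‖ ^ 2
      + 2 * inner ℝ (-(((q + q') / 2) • F)) ((u' : H) - u)) :
    savEnergy e lam u' v' q' = savEnergy e lam u v q + inner ℝ v G + ‖G‖ ^ 2 / 2 ∧
      ‖v + G‖ ≤ 2 * savEnergy e lam u' v' q' := by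
  rw [inner_neg_left, real_inner_smul_left] at hbal
  have hq2 : inner ℝ F ((u' : H) - u) = 2 * (q' - q) := by linarith
  rw [hq2] at hbal
  have h1 : savEnergy e lam u' v' q' = savEnergy e lam u (v + G) q := by
    unfold savEnergy; linarith
  refine ⟨?_, h1 ▸ norm_le_savEnergy u (v + G) q⟩
  rw [h1]
  unfold savEnergy
  linarith [norm_add_sq_real v G]

end Energy

/-! ### One step of the schemes and growth of the energy moments -/

section Scheme

variable {Ω : Type*} {mΩ : MeasurableSpace Ω} {P : Measure Ω} {ℱ : Filtration ℝ≥0 mΩ}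
  {β : ℕ → ℝ≥0 → Ω → ℝ} {d : ℕ} {O : Set (Pt d)} {lam : ℕ → ℝ} {e : HilbertBasis ℕ ℝ (L2 O)}
  {R : L2 O →L[ℝ] L2 O} {k : ℕ} {delta0 : ℝ} {Ft : ℝ → ℝ} {f : HdotOne e lam → L2 O}
  {g : HdotOne e lam → (Fin d → L2 O) → NoiseOp R} {u₀ : Ω → HdotOne e lam} {v₀ : Ω → L2 O}
  {x : Extrapolation} {N : ℕ} {τ : ℝ≥0} {u : ℕ → Ω → HdotOne e lam} {v : ℕ → Ω → L2 O}
  {q : ℕ → Ω → ℝ}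

/-- What the estimates use of one step of either scheme. -/
lemma scheme_step (he : IsDirichletEigenbasis O lam e)
    (h : IsMidpointSAV P ℱ β delta0 Ft f g u₀ v₀ x N τ u v q ∨
      IsExponentialSAV P ℱ β delta0 Ft f g u₀ v₀ x N τ u v q) :
    IsSAVProcess P ℱ delta0 Ft f u₀ v₀ x N τ u v q ∧
    ∃ G : ℕ → Ω → L2 O, ∀ n < N,
      IsNoiseIncrement P e β (n * τ) ((n + 1 : ℕ) * τ) (fun ω => gTheta g (u n ω)) (G n) ∧
      ∀ᵐ ω ∂P,
        savEnergy e lam (u (n + 1) ω) (v (n + 1) ω) (q (n + 1) ω)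
          = savEnergy e lam (u n ω) (v n ω) (q n ω) + inner ℝ (v n ω) (G n ω) + ‖G n ω‖ ^ 2 / 2 ∧
        ‖v n ω + G n ω‖ ≤ 2 * savEnergy e lam (u (n + 1) ω) (v (n + 1) ω) (q (n + 1) ω) ∧
        ‖(u (n + 1) ω : L2 O) - u n ω‖ ≤ τ * (hdotNorm e lam (u n ω) + ‖v n ω + G n ω‖
          + ‖v (n + 1) ω‖ + τ * (|(q n ω + q (n + 1) ω) / 2|
            * ‖scaledDrift delta0 Ft f (x.hat (fun m => u m ω) n)‖)) := by
  rcases h with ⟨hS, G, hG⟩ | ⟨hS, G, hG⟩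
  · refine ⟨hS, G, fun n hn => ⟨(hG n hn).1, ?_⟩⟩
    filter_upwards [hS.step_q n hn, (hG n hn).2] with ω hq hstep
    obtain ⟨hu, hv⟩ := hstep
    -- The noise term in the displacement equation is absorbed into the kicked velocity `v + G`.
    have hu' : (u (n + 1) ω : L2 O)
        = u n ω + ((τ : ℝ) / 2) • ((v n ω + G n ω) + v (n + 1) ω) := by
      rw [hu]; module
    have hbal := midpoint_energy_balance he.pos (e := e) (τ := τ) (u := u n ω) (u' := u (n + 1) ω)
      (w := v n ω + G n ω) (v' := v (n + 1) ω) (y := -(((q n ω + q (n + 1) ω) / 2) •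
        scaledDrift delta0 Ft f (x.hat (fun m => u m ω) n))) hu' (fun i => by
          rw [hv i]
          simp only [map_add, map_neg, map_smul, lp.coeFn_add, lp.coeFn_neg, lp.coeFn_smul,
            Pi.add_apply, Pi.neg_apply, Pi.smul_apply, smul_eq_mul]
          ring)
    obtain ⟨h1, h2⟩ := savEnergy_step hq hbal
    refine ⟨h1, h2, (norm_midpoint_increment_le τ.coe_nonneg hu').trans ?_⟩
    refine mul_le_mul_of_nonneg_left ?_ τ.coe_nonneg
    have := hdotNorm_nonneg (u n ω)
    have : 0 ≤ (τ : ℝ) * (|(q n ω + q (n + 1) ω) / 2|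
            * ‖scaledDrift delta0 Ft f (x.hat (fun m => u m ω) n)‖) := by positivity
    linarith
  · refine ⟨hS, G, fun n hn => ⟨(hG n hn).1, ?_⟩⟩
    filter_upwards [hS.step_q n hn, (hG n hn).2] with ω hq hstep
    obtain ⟨h1, h2⟩ := savEnergy_step hq (exponential_energy_balance he.pos he.mono hstep)
    refine ⟨h1, h2, (norm_exponential_increment_le he.pos he.mono τ.coe_nonneg hstep).trans ?_⟩
    rw [norm_neg, norm_smul, Real.norm_eq_abs]
    refine mul_le_mul_of_nonneg_left ?_ τ.coe_nonneg
    linarith [norm_nonneg (v (n + 1) ω)]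

lemma IsSAVProcess.measurable_savEnergy (hS : IsSAVProcess P ℱ delta0 Ft f u₀ v₀ x N τ u v q)
    {n : ℕ} (hn : n ≤ N) :
    Measurable[ℱ (n * τ)] fun ω => savEnergy e lam (u n ω) (v n ω) (q n ω) := by
  have h1 := @measurable_hdotNorm _ _ _ e lam Ω (ℱ (n * τ)) (u n) (hS.adapted_u n hn)
  have h2 := (hS.adapted_v n hn).norm.measurable
  have h3 := (hS.adapted_q n hn).measurable
  unfold savEnergy
  exact (((measurable_const.add ((h1.pow_const 2).div_const 2)).add
    ((h2.pow_const 2).div_const 2)).add (h3.pow_const 2))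

lemma SuperlinearAssumption.stronglyMeasurable_noise
    (hfg : SuperlinearAssumption O lam e R k delta0 Ft f g) {α : Type*} [mα : MeasurableSpace α]
    {w : α → HdotOne e lam} (hw : StronglyMeasurable fun a => (w a : L2 O)) (i : ℕ) :
    StronglyMeasurable fun a => (gTheta g (w a)).compSqrt (e i) := by
  obtain ⟨b, -, hb⟩ := hfg.g_lipschitz
  exact stronglyMeasurable_of_locally_lipschitz
    (S := fun u : HdotOne e lam => (gTheta g u).compSqrt (e i)) (b := b)
    (fun u w => (norm_compSqrt_sub_le (hfg.g_hs _ _) (hfg.g_hs _ _) i).trans (hb u w)) hw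

/-- Linear growth of `g` in the `Ḣ¹` norm makes the noise variance linear in the energy, which is
what closes the moment recursion. The factor 6 is not sharp. -/
lemma sum_noise_sq_le (hfg : SuperlinearAssumption O lam e R k delta0 Ft f g) {c : ℝ} (hc : 0 < c)
    (hg : ∀ u : HdotOne e lam, hsNorm e (gTheta g u) ≤ c * (1 + hdotNorm e lam u))
    (M : ℕ) (u : HdotOne e lam) (v : L2 O) (q : ℝ) :
    ∑ k ∈ Finset.range M, ‖(gTheta g u).compSqrt (e k)‖ ^ 2
      ≤ 6 * c ^ 2 * savEnergy e lam u v q := by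
  refine (sum_norm_compSqrt_sq_le (hfg.g_hs _ _).2 M).trans ?_
  have h0 : 0 ≤ hsNorm e (gTheta g u) := Real.sqrt_nonneg _
  calc hsNorm e (gTheta g u) ^ 2 ≤ (c * (1 + hdotNorm e lam u)) ^ 2 :=
        pow_le_pow_left₀ h0 (hg u) 2
    _ = c ^ 2 * (1 + hdotNorm e lam u) ^ 2 := by ring
    _ ≤ c ^ 2 * (6 * savEnergy e lam u v q) := by
        gcongr
        unfold savEnergy
        nlinarith [sq_nonneg (hdotNorm e lam u - 1), sq_nonneg ‖v‖, sq_nonneg q]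
    _ = _ := by ring

/-- Moments of the energy along a numerical solution grow at most exponentially in time. -/
lemma lintegral_savEnergy_pow_le [IsProbabilityMeasure P] (he : IsDirichletEigenbasis O lam e)
    (hfg : SuperlinearAssumption O lam e R k delta0 Ft f g) {c : ℝ} (hc : 0 < c)
    (hg : ∀ u : HdotOne e lam, hsNorm e (gTheta g u) ≤ c * (1 + hdotNorm e lam u))
    (hβ : IsBrownianSequence P ℱ β) {T : ℝ≥0} (hN : 1 ≤ N) (hT : N * τ = T)
    (h : IsMidpointSAV P ℱ β delta0 Ft f g u₀ v₀ x N τ u v q ∨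
      IsExponentialSAV P ℱ β delta0 Ft f g u₀ v₀ x N τ u v q) (m : ℕ) {n : ℕ} (hn : n ≤ N) :
    ∫⁻ ω, ENNReal.ofReal (savEnergy e lam (u n ω) (v n ω) (q n ω) ^ m) ∂P
      ≤ ENNReal.ofReal (Real.exp (stepRate m (6 * c ^ 2) T * T)) *
        ∫⁻ ω, ENNReal.ofReal (savEnergy e lam (u 0 ω) (v 0 ω) (q 0 ω) ^ m) ∂P := by
  obtain ⟨hS, G, hG⟩ := scheme_step he h
  have hτT : τ ≤ T := by
    rw [← hT]
    exact le_mul_of_one_le_left zero_le (by exact_mod_cast hN)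
  set ρ := stepRate m (6 * c ^ 2) T with hρ
  have hρ0 : 0 ≤ ρ := stepRate_nonneg m (by positivity) T.coe_nonneg
  have hstep : ∀ n < N,
      ∫⁻ ω, ENNReal.ofReal (savEnergy e lam (u (n + 1) ω) (v (n + 1) ω) (q (n + 1) ω) ^ m) ∂P
        ≤ ENNReal.ofReal (1 + ρ * τ) *
          ∫⁻ ω, ENNReal.ofReal (savEnergy e lam (u n ω) (v n ω) (q n ω) ^ m) ∂P := by
    intro n hn
    obtain ⟨hinc, hae⟩ := hG n hn
    have ht : ((n + 1 : ℕ) : ℝ≥0) * τ = n * τ + τ := by push_cast; ring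
    rw [IsNoiseIncrement, ht] at hinc
    -- The frozen variable is the whole past: `α` is `Ω` with the σ-algebra `ℱ (n * τ)`, and `Y` is
    -- the identity.
    have := @lintegral_energy_pow_step_le Ω mΩ P (L2 O) _ _ _ Ω (ℱ (n * τ)) id
      (measurable_id'' (ℱ.le _)) (fun k ω => β k (n * τ + τ) ω - β k (n * τ) ω) τ T hτT
      (hβ.measurable_increment _ _) (hβ.hasLaw_increment _ _) (hβ.iIndepFun_increment _ _)
      (hβ.indepFun_past le_self_add) (fun k ω => (gTheta g (u n ω)).compSqrt (e k))
      (fun k => hfg.stronglyMeasurable_noise (mα := ℱ (n * τ)) (hS.adapted_u n hn.le) k) (v n) (hS.adapted_v n hn.le)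
      (fun ω => savEnergy e lam (u n ω) (v n ω) (q n ω)) (hS.measurable_savEnergy hn.le)
      (fun ω => zero_lt_one.trans_le (one_le_savEnergy _ _ _))
      (fun ω => by
        unfold savEnergy
        nlinarith [sq_nonneg (hdotNorm e lam (u n ω)), sq_nonneg (q n ω)])
      (6 * c ^ 2) (fun M ω => sum_noise_sq_le hfg hc hg M _ _ _) (G n) hinc m
    refine le_trans (le_of_eq (lintegral_congr_ae ?_)) this
    filter_upwards [hae] with ω hω
    rw [hω.1]
    rfl
  have hpow : ∀ n ≤ N, ∫⁻ ω, ENNReal.ofReal (savEnergy e lam (u n ω) (v n ω) (q n ω) ^ m) ∂P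
      ≤ ENNReal.ofReal ((1 + ρ * τ) ^ n) *
        ∫⁻ ω, ENNReal.ofReal (savEnergy e lam (u 0 ω) (v 0 ω) (q 0 ω) ^ m) ∂P := by
    intro n
    induction n with
    | zero => intro _; simp
    | succ n ih =>
      intro hn
      refine (hstep n hn).trans ?_
      rw [pow_succ', ENNReal.ofReal_mul (by positivity), mul_assoc]
      gcongr
      exact ih (Nat.le_of_succ_le hn)
  refine (hpow n hn).trans ?_
  gcongr
  calc (1 + ρ * τ) ^ n ≤ (1 + ρ * τ) ^ N :=
        pow_le_pow_right₀ (le_add_of_nonneg_right (by positivity)) hn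
    _ ≤ Real.exp (ρ * τ) ^ N := by
        gcongr
        linarith [Real.add_one_le_exp (ρ * τ)]
    _ = Real.exp (ρ * T) := by
        rw [← Real.exp_nat_mul, ← hT]
        push_cast
        ring_nf

end Scheme

lemma integrable_one_add_pow {Ω : Type*} {mΩ : MeasurableSpace Ω} {P : Measure Ω}
    [IsFiniteMeasure P] {φ : Ω → ℝ} (hφ0 : ∀ ω, 0 ≤ φ ω) (hφ : ∀ r : ℝ≥0, MemLp φ r P) (n : ℕ) :
    Integrable (fun ω => (1 + φ ω) ^ n) P := by
  have hn := hφ n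
  rw [ENNReal.coe_natCast] at hn
  have h : MemLp ((fun _ => (1 : ℝ)) + φ) (n : ℝ≥0∞) P := (memLp_const (1 : ℝ)).add hn
  refine h.integrable_norm_pow'.congr (ae_of_all _ fun ω => ?_)
  simp only [Pi.add_apply, Real.norm_of_nonneg (add_nonneg zero_le_one (hφ0 ω))]

/-! ### Moments of the initial energy and the pathwise increment bound -/

section Increment

variable {Ω : Type*} {mΩ : MeasurableSpace Ω} {P : Measure Ω} {ℱ : Filtration ℝ≥0 mΩ}
  {β : ℕ → ℝ≥0 → Ω → ℝ} {d : ℕ} {O : Set (Pt d)} {lam : ℕ → ℝ} {e : HilbertBasis ℕ ℝ (L2 O)}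
  {R : L2 O →L[ℝ] L2 O} {k : ℕ} {delta0 : ℝ} {Ft : ℝ → ℝ} {f : HdotOne e lam → L2 O}
  {g : HdotOne e lam → (Fin d → L2 O) → NoiseOp R} {u₀ : Ω → HdotOne e lam} {v₀ : Ω → L2 O}

/-- All moments of the initial energy are finite. -/
lemma exists_initial_moment_bound [IsProbabilityMeasure P] (hO : IsConvexPolygonalDomain O)
    (he : IsDirichletEigenbasis O lam e) (hfg : SuperlinearAssumption O lam e R k delta0 Ft f g)
    (hF : ∃ c : ℝ, 0 < c ∧ ∀ u : HdotOne e lam, c ≤ potential O Ft (u : L2 O) + delta0)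
    (hX₀ : ∀ r : ℝ≥0, MemLp (fun ω => phaseNorm e lam (u₀ ω) (v₀ ω)) r P) (m : ℕ) :
    ∃ A : ℝ, 0 ≤ A ∧ ∀ (ℱ : Filtration ℝ≥0 mΩ) (N : ℕ) (τ : ℝ≥0) (x : Extrapolation)
      (u : ℕ → Ω → HdotOne e lam) (v : ℕ → Ω → L2 O) (q : ℕ → Ω → ℝ),
      IsSAVProcess P ℱ delta0 Ft f u₀ v₀ x N τ u v q →
      ∫⁻ ω, ENNReal.ofReal (savEnergy e lam (u 0 ω) (v 0 ω) (q 0 ω) ^ m) ∂P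
        ≤ ENNReal.ofReal A := by
  obtain ⟨C, hC0, hC⟩ := hfg.potential_le hO he
  obtain ⟨c, hc0, hc⟩ := hF
  let φ : Ω → ℝ := fun ω => phaseNorm e lam (u₀ ω) (v₀ ω)
  have hφ0 : ∀ ω, 0 ≤ φ ω := fun ω => Real.sqrt_nonneg _
  have hδ := hfg.delta0_pos
  -- The initial energy is at most `(1 + C + delta0) * (1 + φ) ^ (2 * k + 2)`; the degree comes from
  -- the potential in `q 0 ^ 2`.
  have hint : Integrable (fun ω => (1 + C + delta0) ^ m * (1 + φ ω) ^ ((2 * k + 2) * m)) P :=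
    (integrable_one_add_pow hφ0 hX₀ _).const_mul _
  refine ⟨∫ ω, (1 + C + delta0) ^ m * (1 + φ ω) ^ ((2 * k + 2) * m) ∂P,
    integral_nonneg fun ω => by have := hφ0 ω; positivity, ?_⟩
  intro ℱ N τ x u v q hS
  rw [ofReal_integral_eq_lintegral_ofReal hint
    (ae_of_all _ fun ω => by have := hφ0 ω; simp only [Pi.zero_apply]; positivity)]
  refine lintegral_mono_ae ?_
  filter_upwards [hS.init_u, hS.init_v, hS.init_q] with ω hu hv hq
  refine ENNReal.ofReal_le_ofReal ?_
  rw [pow_mul, ← mul_pow]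
  refine pow_le_pow_left₀ (zero_le_one.trans (one_le_savEnergy _ _ _)) ?_ m
  have h0 := hφ0 ω
  have hsq : hdotNorm e lam (u₀ ω) ^ 2 + ‖v₀ ω‖ ^ 2 = φ ω ^ 2 :=
    (Real.sq_sqrt (by positivity)).symm
  have hle : hdotNorm e lam (u₀ ω) ≤ φ ω :=
    Real.le_sqrt_of_sq_le (by linarith [sq_nonneg ‖v₀ ω‖])
  have hu0 := hdotNorm_nonneg (u₀ ω)
  have hpot : potential O Ft (u₀ ω : L2 O) ≤ C * (1 + φ ω) ^ (2 * k + 2) :=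
    (hC _).trans (by gcongr)
  have h1 : 1 ≤ (1 + φ ω) ^ (2 * k + 2) := one_le_pow₀ (by linarith)
  have h2 : (1 + φ ω) ^ 2 ≤ (1 + φ ω) ^ (2 * k + 2) :=
    pow_le_pow_right₀ (by linarith) (by omega)
  rw [savEnergy, hu, hv, hq, Real.sq_sqrt (hc0.le.trans (hc _))]
  nlinarith

/-- A pathwise polynomial bound for the increments. -/
lemma exists_increment_bound
    (hfg : SuperlinearAssumption O lam e R k delta0 Ft f g)
    (hF : ∃ c : ℝ, 0 < c ∧ ∀ u : HdotOne e lam, c ≤ potential O Ft (u : L2 O) + delta0)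
    (T : ℝ≥0) :
    ∃ D : ℝ, 0 < D ∧ ∀ (τ : ℝ≥0) (_ : τ ≤ T) (x : Extrapolation) (u : ℕ → HdotOne e lam)
      (v : ℕ → L2 O) (q : ℕ → ℝ) (n : ℕ) (w : L2 O),
      ‖w‖ ≤ 2 * savEnergy e lam (u (n + 1)) (v (n + 1)) (q (n + 1)) →
      ‖(u (n + 1) : L2 O) - u n‖ ≤ τ * (hdotNorm e lam (u n) + ‖w‖ + ‖v (n + 1)‖
        + τ * (|(q n + q (n + 1)) / 2| * ‖scaledDrift delta0 Ft f (x.hat u n)‖)) →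
      ‖(u (n + 1) : L2 O) - u n‖ ≤ τ * (D * (savEnergy e lam (u (n - 1)) (v (n - 1)) (q (n - 1))
        + savEnergy e lam (u n) (v n) (q n)
        + savEnergy e lam (u (n + 1)) (v (n + 1)) (q (n + 1))) ^ (2 * k + 2)) := by
  obtain ⟨b, hb, hf⟩ := hfg.f_growth
  obtain ⟨B, hB0, hB⟩ := exists_polynomial_bound b hb
  obtain ⟨c, hc0, hc⟩ := hF
  -- The 6 covers three linear terms, each at most `2 * Z`. The factor 5 comes from `1 + 4 * Z ≤ 5 *
  -- Z`, the factor `(√c)⁻¹` from the lower bound on `F + δ₀`, and `T` from the spare factor `τ ≤ T`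
  -- of the drift.
  refine ⟨6 + T * ((√c)⁻¹ * (B * 5 ^ (2 * k + 1))), by positivity, ?_⟩
  intro τ hτ x u v q n w hw hinc
  set W0 := savEnergy e lam (u (n - 1)) (v (n - 1)) (q (n - 1)) with hW0
  set W1 := savEnergy e lam (u n) (v n) (q n) with hW1
  set W2 := savEnergy e lam (u (n + 1)) (v (n + 1)) (q (n + 1)) with hW2
  have o0 : 1 ≤ W0 := one_le_savEnergy _ _ _
  have o1 : 1 ≤ W1 := one_le_savEnergy _ _ _
  have o2 : 1 ≤ W2 := one_le_savEnergy _ _ _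
  set Z := W0 + W1 + W2 with hZ
  have hZ1 : 1 ≤ Z := by linarith
  have hh0 : hdotNorm e lam (u (n - 1)) ≤ 2 * W0 := hdotNorm_le_savEnergy _ _ _
  have hh1 : hdotNorm e lam (u n) ≤ 2 * W1 := hdotNorm_le_savEnergy _ _ _
  have hv2 : ‖v (n + 1)‖ ≤ 2 * W2 := norm_le_savEnergy _ _ _
  have hq1 : |q n| ≤ W1 := abs_le_savEnergy _ _ _
  have hq2 : |q (n + 1)| ≤ W2 := abs_le_savEnergy _ _ _
  -- The extrapolated value is why the energy at `n - 1` enters. For `n = 0` the truncated index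
  -- makes it the energy at 0, consistent with `u_{-1} = u_0`.
  have hhat : hdotNorm e lam (x.hat u n) ≤ 4 * Z := by
    cases x with
    | current => show hdotNorm e lam (u n) ≤ _; linarith
    | linear =>
      show hdotNorm e lam ((1 / 2 : ℝ) • ((3 : ℝ) • u n - u (n - 1))) ≤ _
      have h1 := hdotNorm_sub_le ((3 : ℝ) • u n) (u (n - 1))
      rw [hdotNorm_smul, abs_of_pos (by norm_num : (0 : ℝ) < 3)] at h1
      rw [hdotNorm_smul, abs_of_pos (by norm_num : (0 : ℝ) < 1 / 2)]
      linarith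
  have hdrift : ‖scaledDrift delta0 Ft f (x.hat u n)‖
      ≤ (√c)⁻¹ * (B * 5 ^ (2 * k + 1)) * Z ^ (2 * k + 1) := by
    rw [scaledDrift, norm_smul, norm_inv, Real.norm_of_nonneg (Real.sqrt_nonneg _)]
    have h1 : ‖f (x.hat u n)‖ ≤ B * (5 * Z) ^ (2 * k + 1) := by
      refine (hf _).trans ((hB _ (hdotNorm_nonneg _)).trans ?_)
      have := hdotNorm_nonneg (x.hat u n)
      gcongr
      linarith
    have h2 : (√(potential O Ft (x.hat u n).1 + delta0))⁻¹ ≤ (√c)⁻¹ :=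
      inv_anti₀ (Real.sqrt_pos.2 hc0) (Real.sqrt_le_sqrt (hc _))
    calc _ ≤ (√c)⁻¹ * (B * (5 * Z) ^ (2 * k + 1)) := by gcongr
      _ = _ := by rw [mul_pow]; ring
  have hq : |(q n + q (n + 1)) / 2| ≤ Z := by
    rw [abs_div, abs_of_pos (two_pos : (0 : ℝ) < 2)]
    have := abs_add_le (q n) (q (n + 1))
    linarith
  refine hinc.trans (mul_le_mul_of_nonneg_left ?_ τ.coe_nonneg)
  have hZp : Z ≤ Z ^ (2 * k + 2) := le_self_pow₀ hZ1 (by omega)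
  have hτ' : (τ : ℝ) ≤ T := hτ
  have hlast : (τ : ℝ) * (|(q n + q (n + 1)) / 2| * ‖scaledDrift delta0 Ft f (x.hat u n)‖)
      ≤ T * ((√c)⁻¹ * (B * 5 ^ (2 * k + 1))) * Z ^ (2 * k + 2) := by
    calc _ ≤ (T : ℝ) * (Z * ((√c)⁻¹ * (B * 5 ^ (2 * k + 1)) * Z ^ (2 * k + 1))) := by gcongr
      _ = _ := by ring
  rw [add_mul]
  linarith

end Increment

lemma sum_three_pow_le {a b c : ℝ} (ha : 0 ≤ a) (hb : 0 ≤ b) (hc : 0 ≤ c) (n : ℕ) :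
    (a + b + c) ^ n ≤ 3 ^ n * (a ^ n + b ^ n + c ^ n) := by
  have ha' := pow_nonneg ha n
  have hb' := pow_nonneg hb n
  have hc' := pow_nonneg hc n
  have key : ∀ y : ℝ, a ≤ y → b ≤ y → c ≤ y → (a + b + c) ^ n ≤ 3 ^ n * y ^ n := by
    intro y h1 h2 h3
    rw [← mul_pow]
    exact pow_le_pow_left₀ (by positivity) (by linarith) n
  have h3 : (0 : ℝ) < 3 ^ n := by positivity
  rcases le_total a b with h | h <;> rcases le_total b c with h' | h' <;>
    rcases le_total a c with h'' | h''
  all_goals first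
    | exact (key a (by linarith) (by linarith) (by linarith)).trans (by gcongr; linarith)
    | exact (key b (by linarith) (by linarith) (by linarith)).trans (by gcongr; linarith)
    | exact (key c (by linarith) (by linarith) (by linarith)).trans (by gcongr; linarith)

end SAVWave

/-! ### The increment estimate -/

theorem lemma4p1
    (d : ℕ) (hd1 : 1 ≤ d) (hd3 : d ≤ 3)
    (O : Set (SAVWave.Pt d)) (hO : SAVWave.IsConvexPolygonalDomain O)
    (lam : ℕ → ℝ) (e : HilbertBasis ℕ ℝ (SAVWave.L2 O))
    (he : SAVWave.IsDirichletEigenbasis O lam e)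
    (Q R : SAVWave.L2 O →L[ℝ] SAVWave.L2 O) (hQ : SAVWave.IsCovarianceWithSqrt e Q R)
    (k : ℕ) (delta0 : ℝ) (Ft : ℝ → ℝ)
    (f : SAVWave.HdotOne e lam → SAVWave.L2 O)
    (g : SAVWave.HdotOne e lam → (Fin d → SAVWave.L2 O) → SAVWave.NoiseOp R)
    (hfg : SAVWave.SuperlinearAssumption O lam e R k delta0 Ft f g)
    (hg : ∃ c : ℝ, 0 < c ∧ ∀ u : SAVWave.HdotOne e lam,
      SAVWave.hsNorm e (SAVWave.gTheta g u) ≤ c * (1 + SAVWave.hdotNorm e lam u))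
    (hF : ∃ c : ℝ, 0 < c ∧ ∀ u : SAVWave.HdotOne e lam,
      c ≤ SAVWave.potential O Ft (u : SAVWave.L2 O) + delta0)
    (T : ℝ≥0) (hT : 0 < T)
    {Ω : Type*} {mΩ : MeasurableSpace Ω} (P : Measure Ω) [IsProbabilityMeasure P]
    (u₀ : Ω → SAVWave.HdotOne e lam) (v₀ : Ω → SAVWave.L2 O)
    (hX₀ : ∀ r : ℝ≥0, MemLp (fun ω => SAVWave.phaseNorm e lam (u₀ ω) (v₀ ω)) r P)
    (p : ℝ) (hp : 1 ≤ p) :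
    ∃ C : ℝ, 0 < C ∧
      ∀ (ℱ : Filtration ℝ≥0 mΩ) (β : ℕ → ℝ≥0 → Ω → ℝ),
        SAVWave.IsBrownianSequence P ℱ β →
        StronglyMeasurable[ℱ 0] (fun ω => (u₀ ω : SAVWave.L2 O)) →
        StronglyMeasurable[ℱ 0] v₀ →
        ∀ (N : ℕ) (τ : ℝ≥0), 1 ≤ N → N * τ = T →
        ∀ (x : SAVWave.Extrapolation)
          (u : ℕ → Ω → SAVWave.HdotOne e lam) (v : ℕ → Ω → SAVWave.L2 O) (q : ℕ → Ω → ℝ),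
          (SAVWave.IsMidpointSAV P ℱ β delta0 Ft f g u₀ v₀ x N τ u v q ∨
            SAVWave.IsExponentialSAV P ℱ β delta0 Ft f g u₀ v₀ x N τ u v q) →
          ⨆ j : Fin N, ∫⁻ ω, ENNReal.ofReal
              (‖(u ((j : ℕ) + 1) ω : SAVWave.L2 O) - (u j ω : SAVWave.L2 O)‖ ^ p) ∂P
            ≤ ENNReal.ofReal (C * (τ : ℝ) ^ p) := by
  obtain ⟨c, hc0, hc⟩ := hg
  obtain ⟨D, hD0, hD⟩ := SAVWave.exists_increment_bound hfg hF T
  -- The moment recursion is for integer exponents. Rounding up is harmless because the sum `Z` of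
  -- energies is at least 1.
  let K : ℕ := ⌈((2 * k + 2 : ℕ) : ℝ) * p⌉₊
  obtain ⟨A, hA0, hA⟩ := SAVWave.exists_initial_moment_bound (P := P) hO he hfg hF hX₀ K
  let E : ℝ := Real.exp (SAVWave.stepRate K (6 * c ^ 2) T * T) * A
  have hE0 : 0 ≤ E := mul_nonneg (Real.exp_pos _).le hA0
  have hp0 : 0 ≤ p := zero_le_one.trans hp
  -- The added 1 makes the constant positive, since `E` is only known to be nonnegative. The three
  -- copies of `E` bound the energy moments at `n - 1`, `n` and `n + 1`.
  refine ⟨D ^ p * 3 ^ K * (E + E + E) + 1, by positivity, ?_⟩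
  intro ℱ β hβ _ _ N τ hN hNτ x u v q hscheme
  obtain ⟨hS, G, hG⟩ := SAVWave.scheme_step he hscheme
  have hτT : τ ≤ T := by
    rw [← hNτ]
    exact le_mul_of_one_le_left zero_le (by exact_mod_cast hN)
  let W : ℕ → Ω → ℝ := fun n ω => SAVWave.savEnergy e lam (u n ω) (v n ω) (q n ω)
  have hW1 : ∀ n ω, 1 ≤ W n ω := fun n ω => SAVWave.one_le_savEnergy _ _ _
  have hmom : ∀ n ≤ N, ∫⁻ ω, ENNReal.ofReal (W n ω ^ K) ∂P ≤ ENNReal.ofReal E := by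
    intro n hn
    refine (SAVWave.lintegral_savEnergy_pow_le he hfg hc0 hc hβ hN hNτ hscheme K hn).trans ?_
    rw [ENNReal.ofReal_mul (Real.exp_pos _).le]
    gcongr
    exact hA ℱ N τ x u v q hS
  have hmeas : ∀ n ≤ N, Measurable fun ω => ENNReal.ofReal (W n ω ^ K) := fun n hn =>
    (((hS.measurable_savEnergy hn).mono (ℱ.le _) le_rfl).pow_const K).ennreal_ofReal
  refine iSup_le fun j => ?_
  obtain ⟨n, hn⟩ := j
  have hpt : ∀ᵐ ω ∂P, ENNReal.ofReal (‖(u (n + 1) ω : SAVWave.L2 O) - u n ω‖ ^ p)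
      ≤ ENNReal.ofReal ((τ : ℝ) ^ p * (D ^ p * 3 ^ K)) * (ENNReal.ofReal (W (n - 1) ω ^ K)
        + ENNReal.ofReal (W n ω ^ K) + ENNReal.ofReal (W (n + 1) ω ^ K)) := by
    filter_upwards [(hG n hn).2] with ω hω
    have h0 := zero_le_one.trans (hW1 (n - 1) ω)
    have h1 := zero_le_one.trans (hW1 n ω)
    have h2 := zero_le_one.trans (hW1 (n + 1) ω)
    have hb := hD τ hτT x (fun m => u m ω) (fun m => v m ω) (fun m => q m ω) n _ hω.2.1 hω.2.2
    rw [← ENNReal.ofReal_add (by positivity) (by positivity),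
      ← ENNReal.ofReal_add (by positivity) (by positivity), ← ENNReal.ofReal_mul (by positivity)]
    refine ENNReal.ofReal_le_ofReal ?_
    set Z : ℝ := W (n - 1) ω + W n ω + W (n + 1) ω with hZ
    have hZ1 : 1 ≤ Z := by linarith [hW1 n ω]
    have hZ0 : 0 ≤ Z := zero_le_one.trans hZ1
    calc ‖(u (n + 1) ω : SAVWave.L2 O) - u n ω‖ ^ p
        ≤ (τ * (D * Z ^ (2 * k + 2))) ^ p := Real.rpow_le_rpow (norm_nonneg _) hb hp0
      _ = (τ : ℝ) ^ p * (D ^ p * Z ^ (((2 * k + 2 : ℕ) : ℝ) * p)) := by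
          rw [Real.mul_rpow τ.coe_nonneg (by positivity), Real.mul_rpow hD0.le (by positivity),
            ← Real.rpow_natCast_mul hZ0]
      _ ≤ (τ : ℝ) ^ p * (D ^ p * Z ^ K) := by
          gcongr
          rw [← Real.rpow_natCast Z K]
          exact Real.rpow_le_rpow_of_exponent_le hZ1 (Nat.le_ceil _)
      _ ≤ (τ : ℝ) ^ p * (D ^ p * (3 ^ K * (W (n - 1) ω ^ K + W n ω ^ K + W (n + 1) ω ^ K))) := by
          gcongr
          exact SAVWave.sum_three_pow_le h0 h1 h2 K
      _ = _ := by ring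
  calc _ ≤ ∫⁻ ω, ENNReal.ofReal ((τ : ℝ) ^ p * (D ^ p * 3 ^ K)) *
        (ENNReal.ofReal (W (n - 1) ω ^ K) + ENNReal.ofReal (W n ω ^ K)
          + ENNReal.ofReal (W (n + 1) ω ^ K)) ∂P := lintegral_mono_ae hpt
    _ ≤ ENNReal.ofReal ((τ : ℝ) ^ p * (D ^ p * 3 ^ K)) *
        (ENNReal.ofReal E + ENNReal.ofReal E + ENNReal.ofReal E) := by
        rw [lintegral_const_mul' _ _ ENNReal.ofReal_ne_top,
          lintegral_add_right _ (hmeas (n + 1) hn), lintegral_add_right _ (hmeas n hn.le)]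
        gcongr
        · exact hmom _ (by omega)
        · exact hmom _ hn.le
        · exact hmom _ hn
    _ ≤ _ := by
        rw [← ENNReal.ofReal_add hE0 hE0, ← ENNReal.ofReal_add (by positivity) hE0,
          ← ENNReal.ofReal_mul (by positivity)]
        refine ENNReal.ofReal_le_ofReal ?_
        have : 0 ≤ (τ : ℝ) ^ p := by positivity
        linarith
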